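/- Let $\Lambda_0$ be the set of all partitions of positive integers. For $\lambda\in\Lambda_0$ having $m_i$ parts of size $i$ for each $i\ge 1$, put $$k(\lambda)=2\sum_{i<j} i\,m_im_j+\sum_i (i-1)m_i^2,\qquad C_{\mathrm{GL},\lambda}(q)=q^{k(\lambda)}\prod_i q^{\binom{m_i}{2}}(q^{m_i}-1)\cdots(q-1),$$ and let $\Delta(\lambda)$ be the degree of $C_{\mathrm{GL},\lambda}(q)$ as a polynomial in $q$, and $|\lambda|$ the sum of the parts of $\lambda$. For a matrix $\alpha\in\mathrm{GL}(d,q)$ and a monic irreducible polynomial $f$ over $\mathbb{F}_q$, let $\lambda_f(\alpha)$ be the partition whose parts are the exponents $a_1,\dots,a_n$ such that $f^{a_1},\dots,f^{a_n}$ are the powers of $f$ amongst the elementary divisors of $\alpha$. For $\Lambda\subseteq\Lambda_0$, say that $\alpha$ is of $\Lambda$-type if every $\lambda_f(\alpha)$ is either empty or in $\Lambda$, and let $\Lambda_{\mathrm{GL}(d,q)}$ be the probability that a uniformly random element of $\mathrm{GL}(d,q)$ is of $\Lambda$-type. Suppose that $\emptyset\ne\Lambda\subseteq\Lambda_0$ and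 that $(1)\notin\Lambda$, and define $$\sigma=\inf\left\{\frac{\Delta(\lambda)-1}{|\lambda|}\;:\;\lambda\in\Lambda\right\}.$$ Then, for every $d\ge 0$, there is a unique power series in $q^{-1}$, with real coefficients depending only on $\Lambda$ and $d$, that converges to $\Lambda_{\mathrm{GL}(d,q)}$ for every prime power $q>1$; and, whenever $j<d\sigma$, the coefficient of $q^{-j}$ in this expansion is $0$. -/

import Mathlib

open Polynomial
open scoped DirectSum

/-- Partitions of positive integers: pairs of a size `n ≥ 1` and a partition of `n`. -/
abbrev PosPartition : Type := Σ n : ℕ+, Nat.Partition (n : ℕ)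

namespace PosPartition

/-- The size `|lam|`. -/
def size (lam : PosPartition) : ℕ := lam.1

/-- The parts of `lam`, as a multiset. -/
def parts (lam : PosPartition) : Multiset ℕ := lam.2.parts

/-- `m_i`, the number of parts of `lam` equal to `i`. -/
def mult (lam : PosPartition) (i : ℕ) : ℕ := lam.parts.count i

/-- The partition `(1)` of the integer `1`. -/
def single : PosPartition := ⟨1, Nat.Partition.indiscrete _⟩

/-- `k(lam) = 2 ∑_{i<j} i m_i m_j + ∑_i (i-1) m_i ^ 2`, the sums being over the sizes that occur as
parts of `lam` (all positive). -/
def k (lam : PosPartition) : ℕ :=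
  2 * ∑ i ∈ lam.parts.toFinset, ∑ j ∈ lam.parts.toFinset with i < j,
      i * lam.mult i * lam.mult j
    + ∑ i ∈ lam.parts.toFinset, (i - 1) * lam.mult i ^ 2

end PosPartition

/-- The order of `GL(m, q)`, as a polynomial in `q`:
`q ^ (m choose 2) * (q ^ m - 1) ⋯ (q - 1)`. -/
noncomputable def orderGLPoly (m : ℕ) : ℤ[X] :=
  X ^ m.choose 2 * ∏ l ∈ Finset.Icc 1 m, (X ^ l - 1)

/-- `C_{GL,lam}(q) = q ^ k(lam) * ∏_i |GL(m_i, q)|`, as a polynomial in `q`. -/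
noncomputable def centralizerGLPoly (lam : PosPartition) : ℤ[X] :=
  X ^ lam.k * ∏ i ∈ lam.parts.toFinset, orderGLPoly (lam.mult i)

/-- `Δ(lam)`, the degree of `C_{GL,lam}(q)` in `q`. -/
noncomputable def PosPartition.Delta (lam : PosPartition) : ℕ :=
  (centralizerGLPoly lam).natDegree

/-- The prime powers `p i ^ e i`, listed with repetition, are the elementary divisors of the square
matrix `A`: the `F[X]`-module `F ^ d`, on which `X` acts as `A`, is isomorphic to the direct sum of
the modules `F[X] / (p i ^ e i)`, with `p i` monic irreducible and `e i ≥ 1`.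
(By the structure theorem such a list exists and is unique up to order.) -/
def IsElementaryDivisors {F : Type*} [Field F] {d : ℕ} (A : Matrix (Fin d) (Fin d) F)
    {r : ℕ} (p : Fin r → F[X]) (e : Fin r → ℕ) : Prop :=
  (∀ i, (p i).Monic ∧ Irreducible (p i) ∧ 0 < e i) ∧
    Nonempty (Module.AEval' (Matrix.toLin' A) ≃ₗ[F[X]]
      ⨁ i : Fin r, F[X] ⧸ Ideal.span {p i ^ e i})

open Classical in
/-- The parts of the partition attached to the polynomial `f` by the list `p i ^ e i`: the
exponents `e i` of those members of the list which are powers of `f`. -/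
noncomputable def partsAt {F : Type*} [Field F] {r : ℕ} (p : Fin r → F[X]) (e : Fin r → ℕ)
    (f : F[X]) : Multiset ℕ :=
  (Finset.univ.filter fun i => p i = f).val.map e

/-- `A` is of `Lam`-type: for every monic irreducible `f`, the partition formed by the exponents of
the powers of `f` among the elementary divisors of `A` is empty or belongs to `Lam`. -/
def IsOfType (Lam : Set PosPartition) {F : Type*} [Field F] {d : ℕ}
    (A : Matrix (Fin d) (Fin d) F) : Prop :=
  ∃ (r : ℕ) (p : Fin r → F[X]) (e : Fin r → ℕ), IsElementaryDivisors A p e ∧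
    ∀ f : F[X], f.Monic → Irreducible f →
      partsAt p e f = 0 ∨ ∃ lam ∈ Lam, lam.parts = partsAt p e f

/-- The probability that a uniformly random element of `GL(d, F)` is of `Lam`-type
(`F` a finite field). -/
noncomputable def probGL (Lam : Set PosPartition) (d : ℕ) (F : Type*) [Field F] : ℝ :=
  (Nat.card {g : GL (Fin d) F // IsOfType Lam (g : Matrix (Fin d) (Fin d) F)} : ℝ) /
    (Nat.card (GL (Fin d) F) : ℝ)

/-- `φ` is an expansion of `Lam_{GL(d,q)}` as a power series in `q⁻¹`: for every finite field `F`,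
with `q` elements, the series `∑ j, (coeff j φ) * q ^ (-j)` converges to the probability that a
random element of `GL(d, F)` is of `Lam`-type. -/
def IsExpansionGL (Lam : Set PosPartition) (d : ℕ) (φ : PowerSeries ℝ) : Prop :=
  ∀ (F : Type) [Field F] [Finite F],
    HasSum (fun j : ℕ => PowerSeries.coeff j φ * ((Nat.card F : ℝ)⁻¹) ^ j) (probGL Lam d F)

/-- `σ = inf {(Δ(lam) - 1) / |lam| : lam ∈ Lam}`. -/
noncomputable def sigmaGL (Lam : Set PosPartition) : ℝ :=
  sInf ((fun lam : PosPartition => ((lam.Delta : ℝ) - 1) / (lam.size : ℝ)) '' Lam)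

/-!
The matrices of a given type form a conjugacy class, of size `|GL(d, F)|` divided by the number of
automorphisms of the corresponding `F[X]`-module (`card_equiv_mul_card_equiv`). That number is the
product over `f` of `C_{GL, λ_f}(q ^ deg f)` (`card_typeModule_equiv`): the `f`-primary parts do not
interact, and an endomorphism of `∏ i, F[X] / (f ^ e i)` is invertible exactly when the diagonal
blocks of its reduction modulo `f` are (`card_primaryModule_equiv_mul`). As non-isomorphic modules
have different types (`eq_of_typeModule_equiv`), the probability that a random element of `GL(d, F)`
is of `Lam`-type is the coefficient of `u ^ d` in the cycle index
`∏ f, (1 + ∑ lam ∈ Lam, u ^ (deg f * |lam|) / C_{GL, lam}(q ^ deg f))`, with `f ≠ X` monic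
irreducible (`probGL_eq_coeff_prod`).

Collecting the polynomials of degree `n`, of which there are `N`, turns the product into
`∏ n, (1 + G_n) ^ N`, where `(1 + G_n) ^ N = ∑ k, (choose N k / q ^ (n k)) * (q ^ n G_n) ^ k`.
By Gauss's formula `N / q ^ n`, and so also `choose N k / q ^ (n k)`, is a power series in `q⁻¹`
independent of `F`. A partition `lam` contributes `q ^ n / C_{GL, lam}(q ^ n)` to the coefficient of
`u ^ (n |lam|)` in `q ^ n G_n`: a power series in `q⁻¹` of order `n (Δ(lam) - 1) ≥ n |lam| σ`.
Series in `u` whose coefficient of `u ^ e` is a power series in `q⁻¹` of order at least `e σ` are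
closed under products (`HasExpansions`), which gives the expansion and the vanishing of its
coefficients below `d σ`. The expansion is unique since its values at the points `q⁻¹`, which
accumulate at `0`, determine it.
-/

/-! ### Functions with an expansion in `q⁻¹` -/

/-- `h : I → ℝ` has an expansion in `q⁻¹` of order at least `s`: a single power series, with no
coefficient in degrees below the real number `s`, converges to `h i` at `(q i)⁻¹` for every `i`. -/
def HasExpansion {I : Type*} (q : I → ℝ) (s : ℝ) (h : I → ℝ) : Prop :=
  ∃ φ : PowerSeries ℝ, (∀ i, HasSum (fun j : ℕ => PowerSeries.coeff j φ * ((q i)⁻¹) ^ j) (h i)) ∧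
    ∀ j : ℕ, (j : ℝ) < s → PowerSeries.coeff j φ = 0

namespace HasExpansion

variable {I : Type*} {q : I → ℝ} {s t : ℝ} {h h' : I → ℝ}

theorem mono (hst : s ≤ t) (H : HasExpansion q t h) : HasExpansion q s h := by
  obtain ⟨φ, h1, h2⟩ := H
  exact ⟨φ, h1, fun j hj => h2 j (hj.trans_le hst)⟩

theorem add (H : HasExpansion q s h) (H' : HasExpansion q s h') :
    HasExpansion q s (fun i => h i + h' i) := by
  obtain ⟨φ, h1, h2⟩ := H
  obtain ⟨ψ, h3, h4⟩ := H'
  refine ⟨φ + ψ, fun i => ?_, fun j hj => by simp [h2 j hj, h4 j hj]⟩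
  simpa only [map_add, add_mul] using (h1 i).add (h3 i)

theorem zero : HasExpansion q s (fun _ => 0) :=
  ⟨0, fun i => by simp, fun j _ => by simp⟩

theorem sum {κ : Type*} (S : Finset κ) {f : κ → I → ℝ} (H : ∀ a ∈ S, HasExpansion q s (f a)) :
    HasExpansion q s (fun i => ∑ a ∈ S, f a i) := by
  classical
  induction S using Finset.induction_on with
  | empty => simpa using zero
  | insert a S ha ih =>
    simp only [Finset.sum_insert ha]
    exact (H a (by simp)).add (ih fun b hb => H b (by simp [hb]))

theorem inv_pow (m : ℕ) : HasExpansion q m (fun i => (q i)⁻¹ ^ m) := by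
  refine ⟨PowerSeries.X ^ m, fun i => ?_, fun j hj => ?_⟩
  · convert hasSum_ite_eq m ((q i)⁻¹ ^ m) using 2 with j
    rw [PowerSeries.coeff_X_pow]
    split_ifs with hj <;> simp [hj]
  · rw [PowerSeries.coeff_X_pow, if_neg]
    rintro rfl
    exact lt_irrefl _ hj

theorem mul (H : HasExpansion q s h) (H' : HasExpansion q t h') :
    HasExpansion q (s + t) (fun i => h i * h' i) := by
  obtain ⟨φ, h1, h2⟩ := H
  obtain ⟨ψ, h3, h4⟩ := H'
  refine ⟨φ * ψ, fun i => ?_, fun j hj => ?_⟩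
  · have hs1 : Summable fun j => ‖PowerSeries.coeff j φ * (q i)⁻¹ ^ j‖ := (h1 i).summable.norm
    have hs2 : Summable fun j => ‖PowerSeries.coeff j ψ * (q i)⁻¹ ^ j‖ := (h3 i).summable.norm
    have h5 := (summable_norm_sum_mul_antidiagonal_of_summable_norm hs1 hs2).of_norm.hasSum
    rw [← tsum_mul_tsum_eq_tsum_sum_antidiagonal_of_summable_norm hs1 hs2, (h1 i).tsum_eq,
      (h3 i).tsum_eq] at h5
    refine (congrArg (HasSum · (h i * h' i)) (funext fun n => ?_)).mpr h5
    rw [PowerSeries.coeff_mul, Finset.sum_mul]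
    refine Finset.sum_congr rfl fun p hp => ?_
    rw [← Finset.HasAntidiagonal.mem_antidiagonal.mp hp, pow_add]
    ring
  · rw [PowerSeries.coeff_mul]
    refine Finset.sum_eq_zero fun p hp => ?_
    have hp' : ((p.1 : ℝ) + p.2) = j := by exact_mod_cast Finset.HasAntidiagonal.mem_antidiagonal.mp hp
    by_cases hps : (p.1 : ℝ) < s
    · rw [h2 _ hps, zero_mul]
    · rw [h4 p.2 (by linarith), mul_zero]

theorem const (c : ℝ) : HasExpansion q 0 (fun _ => c) := by
  refine ⟨PowerSeries.C c, fun i => ?_, fun j hj => absurd hj (by simp)⟩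
  convert hasSum_ite_eq 0 c using 2 with j
  rw [PowerSeries.coeff_C]
  split_ifs with hj <;> simp [hj]

theorem prod {κ : Type*} (S : Finset κ) {f : κ → I → ℝ} {a : κ → ℝ}
    (H : ∀ k ∈ S, HasExpansion q (a k) (f k)) :
    HasExpansion q (∑ k ∈ S, a k) (fun i => ∏ k ∈ S, f k i) := by
  classical
  induction S using Finset.induction_on with
  | empty => simpa using const 1
  | insert b S hb ih =>
    simp only [Finset.prod_insert hb, Finset.sum_insert hb]
    exact (H b (by simp)).mul (ih fun c hc => H c (by simp [hc]))

theorem const_mul (c : ℝ) (H : HasExpansion q s h) : HasExpansion q s (fun i => c * h i) := by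
  simpa using (const c).mul H

theorem inv_one_sub_inv_pow (hq : ∀ i, 1 < q i) {m : ℕ} (hm : m ≠ 0) :
    HasExpansion q 0 (fun i => (1 - (q i)⁻¹ ^ m)⁻¹) := by
  classical
  refine ⟨PowerSeries.mk fun j => if m ∣ j then 1 else 0, fun i => ?_,
    fun j hj => absurd hj (by simp)⟩
  have h0 : 0 < q i := one_pos.trans (hq i)
  have h1 : (q i)⁻¹ ^ m < 1 := pow_lt_one₀ (by positivity) (inv_lt_one_of_one_lt₀ (hq i)) hm
  have h2 := hasSum_geometric_of_lt_one (by positivity) h1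
  have hinj : Function.Injective fun k : ℕ => m * k := mul_right_injective₀ hm
  rw [← hinj.hasSum_iff]
  · convert h2 using 2 with k
    simp [pow_mul]
  · intro j hj
    rw [PowerSeries.coeff_mk, if_neg, zero_mul]
    rintro ⟨k, rfl⟩
    exact hj ⟨k, rfl⟩

/-- A sequence satisfying Gauss's relation `∑_{k ∣ n} k N_k = q ^ n` is `q ^ n` times a power series
in `q⁻¹`. -/
theorem of_sum_divisors (hq : ∀ i, 1 < q i) {N : ℕ → I → ℝ}
    (hN : ∀ n : ℕ, n ≠ 0 → ∀ i, ∑ k ∈ n.divisors, (k : ℝ) * N k i = q i ^ n) :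
    ∀ n : ℕ, n ≠ 0 → HasExpansion q 0 (fun i => N n i * (q i)⁻¹ ^ n) := by
  intro n
  induction n using Nat.strong_induction_on with
  | _ n ih =>
    intro hn
    have key : (fun i => N n i * (q i)⁻¹ ^ n) = fun i => (n : ℝ)⁻¹ * (1 + ∑ k ∈ n.properDivisors,
        (-k : ℝ) * ((N k i * (q i)⁻¹ ^ k) * (q i)⁻¹ ^ (n - k))) := by
      funext i
      have h1 := hN n hn i
      have h0 : q i ≠ 0 := (one_pos.trans (hq i)).ne'
      rw [← Nat.cons_self_properDivisors hn, Finset.sum_cons, add_comm] at h1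
      have h2 : ∑ k ∈ n.properDivisors, (-k : ℝ) * ((N k i * (q i)⁻¹ ^ k) * (q i)⁻¹ ^ (n - k))
          = - (∑ k ∈ n.properDivisors, (k : ℝ) * N k i) * (q i)⁻¹ ^ n := by
        rw [← Finset.sum_neg_distrib, Finset.sum_mul]
        refine Finset.sum_congr rfl fun k hk => ?_
        rw [mul_assoc (N k i), ← pow_add, Nat.add_sub_cancel'
          (Nat.mem_properDivisors.mp hk).2.le]
        ring
      have hn' : (n : ℝ) ≠ 0 := by exact_mod_cast hn
      rw [h2, eq_sub_of_add_eq h1]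
      rw [_root_.inv_pow]
      field_simp
      ring
    rw [key]
    refine const_mul _ ((const 1).add (sum _ fun k hk => const_mul _ ?_))
    obtain ⟨hk, hkn⟩ := Nat.mem_properDivisors.mp hk
    have hk0 : k ≠ 0 := by rintro rfl; exact hn (Nat.eq_zero_of_zero_dvd hk)
    exact ((ih k hkn hk0).mul (inv_pow (n - k))).mono (by positivity)

/-- `choose N k` divided by `q ^ (n k)` has an expansion, if `N / q ^ n` has one. -/
theorem choose {N : I → ℕ} {n : ℕ} (H : HasExpansion q 0 (fun i => (N i : ℝ) * (q i)⁻¹ ^ n))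
    (k : ℕ) : HasExpansion q 0 (fun i => ((N i).choose k : ℝ) * ((q i)⁻¹ ^ n) ^ k) := by
  have key : (fun i => ((N i).choose k : ℝ) * ((q i)⁻¹ ^ n) ^ k) = fun i => (k.factorial : ℝ)⁻¹ *
      ∏ j ∈ Finset.range k, ((N i : ℝ) * (q i)⁻¹ ^ n + (-j : ℝ) * (q i)⁻¹ ^ n) := by
    funext i
    have : ∏ j ∈ Finset.range k, ((N i : ℝ) * (q i)⁻¹ ^ n + (-j : ℝ) * (q i)⁻¹ ^ n) =
        ((N i).descFactorial k : ℝ) * ((q i)⁻¹ ^ n) ^ k := by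
      rw [← descPochhammer_eval_eq_descFactorial, descPochhammer_eval_eq_prod_range]
      simp only [← add_mul, Finset.prod_mul_distrib, Finset.prod_const, Finset.card_range,
        sub_eq_add_neg]
    rw [this, Nat.descFactorial_eq_factorial_mul_choose]
    push_cast
    have : (k.factorial : ℝ) ≠ 0 := by exact_mod_cast k.factorial_ne_zero
    field_simp
  rw [key]
  have := prod (Finset.range k) fun j _ =>
    H.add (const_mul (-j : ℝ) ((inv_pow n).mono (by positivity)))
  exact const_mul _ (by simpa only [Finset.sum_const_zero] using this)

end HasExpansion

/-! ### Power series in `u` whose coefficients have expansions in `q⁻¹` -/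

/-- The coefficient of `u ^ e` has an expansion in `q⁻¹` of order at least `e σ`, for every `e`. -/
def HasExpansions {I : Type*} (q : I → ℝ) (σ : ℝ) (H : I → PowerSeries ℝ) : Prop :=
  ∀ e : ℕ, HasExpansion q (e * σ) (fun i => PowerSeries.coeff e (H i))

namespace HasExpansions

variable {I : Type*} {q : I → ℝ} {σ : ℝ} {H H' : I → PowerSeries ℝ}

theorem one : HasExpansions q σ (fun _ => 1) := by
  intro e
  simp only [PowerSeries.coeff_one]
  split_ifs with he
  · simpa [he] using HasExpansion.const 1
  · exact HasExpansion.zero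

theorem mul (h : HasExpansions q σ H) (h' : HasExpansions q σ H') :
    HasExpansions q σ (fun i => H i * H' i) := by
  intro e
  simp only [PowerSeries.coeff_mul]
  refine HasExpansion.sum _ fun p hp => ?_
  rw [← Finset.HasAntidiagonal.mem_antidiagonal.mp hp]
  exact ((h p.1).mul (h' p.2)).mono (by push_cast; linarith)

theorem pow (h : HasExpansions q σ H) (k : ℕ) : HasExpansions q σ (fun i => H i ^ k) := by
  induction k with
  | zero => simpa using one
  | succ k ih => simpa only [pow_succ] using ih.mul h

theorem prod {κ : Type*} (S : Finset κ) {f : κ → I → PowerSeries ℝ}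
    (h : ∀ a ∈ S, HasExpansions q σ (f a)) : HasExpansions q σ (fun i => ∏ a ∈ S, f a i) := by
  classical
  induction S using Finset.induction_on with
  | empty => simpa using one
  | insert a S ha ih =>
    simp only [Finset.prod_insert ha]
    exact (h a (by simp)).mul (ih fun b hb => h b (by simp [hb]))

/-- The number of factors `N` may be as large as `q ^ n`, provided that `q ^ n G` still has
expansions: the binomial coefficients in `(1 + G) ^ N = ∑ choose N k * G ^ k` grow no faster than
`q ^ (n k)`. -/
theorem one_add_pow (hq : ∀ i, q i ≠ 0) {N : I → ℕ} {n : ℕ} {G : I → PowerSeries ℝ}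
    (hN : HasExpansion q 0 (fun i => (N i : ℝ) * (q i)⁻¹ ^ n))
    (hG : HasExpansions q σ (fun i => PowerSeries.C (q i ^ n) * G i))
    (hG0 : ∀ i, PowerSeries.constantCoeff (G i) = 0) :
    HasExpansions q σ (fun i => (1 + G i) ^ N i) := by
  intro e
  have key : (fun i => PowerSeries.coeff e ((1 + G i) ^ N i)) = fun i =>
      ∑ k ∈ Finset.range (e + 1), ((N i).choose k : ℝ) * ((q i)⁻¹ ^ n) ^ k *
        PowerSeries.coeff e ((PowerSeries.C (q i ^ n) * G i) ^ k) := by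
    funext i
    have hterm : ∀ k, ((N i).choose k : ℝ) * ((q i)⁻¹ ^ n) ^ k *
        PowerSeries.coeff e ((PowerSeries.C (q i ^ n) * G i) ^ k) =
        ((N i).choose k : ℝ) * PowerSeries.coeff e (G i ^ k) := by
      intro k
      have := pow_ne_zero k (pow_ne_zero n (hq i))
      rw [mul_pow, ← map_pow, PowerSeries.coeff_C_mul, inv_pow, inv_pow]
      field_simp
    have hz : ∀ k, e < k → PowerSeries.coeff e (G i ^ k) = 0 := by
      intro k hk
      obtain ⟨g, hg⟩ := PowerSeries.X_dvd_iff.mpr (hG0 i)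
      rw [hg, mul_pow, PowerSeries.coeff_X_pow_mul', if_neg (by omega)]
    simp only [hterm]
    have hb : (1 + G i) ^ N i = ∑ k ∈ Finset.range (N i + 1),
        PowerSeries.C ((N i).choose k : ℝ) * G i ^ k := by
      rw [add_comm, add_pow]
      refine Finset.sum_congr rfl fun k _ => ?_
      simp [mul_comm]
    rw [hb, map_sum]
    simp only [PowerSeries.coeff_C_mul]
    -- both sums agree with the sum over the larger of the two ranges
    have h1 := Finset.sum_subset (f := fun k => ((N i).choose k : ℝ) * PowerSeries.coeff e (G i ^ k))
      (Finset.range_mono (show N i + 1 ≤ max (N i) e + 1 by omega)) (fun k _ hk => by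
        rw [Nat.choose_eq_zero_of_lt (by simpa using hk)]; simp)
    have h2 := Finset.sum_subset (f := fun k => ((N i).choose k : ℝ) * PowerSeries.coeff e (G i ^ k))
      (Finset.range_mono (show e + 1 ≤ max (N i) e + 1 by omega)) (fun k _ hk => by
        rw [hz k (by simpa using hk), mul_zero])
    rw [h1, h2]
  rw [key]
  exact HasExpansion.sum _ fun k _ => ((hN.choose k).mul (hG.pow k e)).mono (by simp)

end HasExpansions

/-! ### Monic irreducible polynomials over a finite field -/

section IrreducibleCount

variable (F : Type*) [Field F]

theorem finite_setOf_natDegree_le [Finite F] (d : ℕ) : {f : F[X] | f.natDegree ≤ d}.Finite := by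
  have : Finite (degreeLT F (d + 1)) := Finite.of_equiv _ (degreeLTEquiv F (d + 1)).symm.toEquiv
  refine (Set.toFinite (degreeLT F (d + 1) : Set F[X])).subset fun f hf => ?_
  rw [SetLike.mem_coe, mem_degreeLT]
  exact degree_le_natDegree.trans_lt (by exact_mod_cast Nat.lt_succ_of_le hf)

/-- The monic irreducible polynomials of degree at most `d`, other than `X`. -/
noncomputable def irreduciblesUpTo [Finite F] (d : ℕ) : Finset F[X] :=
  ((finite_setOf_natDegree_le F d).subset
    (show {f : F[X] | f.Monic ∧ Irreducible f ∧ f ≠ X ∧ f.natDegree ≤ d} ⊆ _ from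
      fun _ h => h.2.2.2)).toFinset

variable {F}

@[simp] theorem mem_irreduciblesUpTo [Finite F] {d : ℕ} {f : F[X]} :
    f ∈ irreduciblesUpTo F d ↔ f.Monic ∧ Irreducible f ∧ f ≠ X ∧ f.natDegree ≤ d := by
  simp [irreduciblesUpTo]

variable (F)

/-- The number of monic irreducible polynomials of degree `n`. -/
noncomputable def irreducibleCount (n : ℕ) : ℕ :=
  Nat.card {f : F[X] // (f.Monic ∧ Irreducible f) ∧ f.natDegree = n}

/-- Gauss's formula: `X ^ (q ^ n) - X` is the product of the monic irreducible polynomials whose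
degree divides `n`. -/
theorem sum_divisors_mul_irreducibleCount [Finite F] {n : ℕ} (hn : n ≠ 0) :
    ∑ k ∈ n.divisors, k * irreducibleCount F k = Nat.card F ^ n := by
  classical
  obtain ⟨p, hp⟩ := CharP.exists F
  have hpdvd : p ∣ Nat.card F ^ n := by
    refine dvd_pow ?_ hn
    rw [← CharP.cast_eq_zero_iff F p]
    have := Fintype.ofFinite F
    rw [Nat.card_eq_fintype_card]
    exact FiniteField.cast_card_eq_zero F
  set P : F[X] := X ^ Nat.card F ^ n - X with hP
  have hP0 : P ≠ 0 := FiniteField.X_pow_card_pow_sub_X_ne_zero F hn Finite.one_lt_card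
  have hdeg : P.natDegree = Nat.card F ^ n :=
    FiniteField.X_pow_card_pow_sub_X_natDegree_eq F hn Finite.one_lt_card
  have hPm : P.Monic := by
    refine monic_X_pow_sub ?_
    rw [degree_X]
    exact_mod_cast Nat.one_lt_pow hn Finite.one_lt_card
  have hnodup : (UniqueFactorizationMonoid.normalizedFactors P).Nodup :=
    (UniqueFactorizationMonoid.squarefree_iff_nodup_normalizedFactors hP0).mp
      (galois_poly_separable p _ hpdvd).squarefree
  set S := (UniqueFactorizationMonoid.normalizedFactors P).toFinset with hS
  have hmem : ∀ f, f ∈ S ↔ (f.Monic ∧ Irreducible f) ∧ f.natDegree ∣ n := by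
    intro f
    rw [hS, Multiset.mem_toFinset, UniqueFactorizationMonoid.mem_normalizedFactors_iff' hP0]
    constructor
    · rintro ⟨h1, h2, h3⟩
      exact ⟨⟨(normalize_eq_self_iff_monic h1.ne_zero).mp h2, h1⟩,
        h1.natDegree_dvd_iff_dvd_X_pow_card_pow_sub_X.mpr h3⟩
    · rintro ⟨⟨h1, h2⟩, h3⟩
      exact ⟨h2, h1.normalize_eq_self, h2.natDegree_dvd_iff_dvd_X_pow_card_pow_sub_X.mp h3⟩
  have hprod : ∏ f ∈ S, f = P := by
    refine eq_of_monic_of_associated (monic_prod_of_monic _ _ fun f hf => ((hmem f).mp hf).1.1)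
      hPm ?_
    rw [hS, Finset.prod_eq_multiset_prod, Multiset.toFinset_val, hnodup.dedup, Multiset.map_id']
    exact UniqueFactorizationMonoid.prod_normalizedFactors hP0
  rw [← hdeg, ← hprod, natDegree_prod_of_monic _ _ fun f hf => ((hmem f).mp hf).1.1,
    ← Finset.sum_fiberwise_of_maps_to (t := n.divisors) (g := natDegree)
      fun f hf => Nat.mem_divisors.mpr ⟨((hmem f).mp hf).2, hn⟩]
  refine Finset.sum_congr rfl fun k hk => ?_
  rw [Finset.sum_congr rfl fun f hf => (Finset.mem_filter.mp hf).2, Finset.sum_const, smul_eq_mul,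
    mul_comm, irreducibleCount]
  congr 1
  rw [Nat.subtype_card]
  intro f
  rw [Finset.mem_filter, hmem]
  constructor
  · rintro ⟨h1, h2⟩
    exact ⟨h1.1, h2⟩
  · rintro ⟨h1, h2⟩
    exact ⟨⟨h1, h2 ▸ Nat.dvd_of_mem_divisors hk⟩, h2⟩

variable {F}

/-- Leaving out `X` lowers the number of monic irreducible polynomials of degree `1` by one. -/
theorem card_filter_irreduciblesUpTo [Finite F] {d n : ℕ} (hn : n ≤ d) :
    (({f ∈ irreduciblesUpTo F d | f.natDegree = n}.card : ℕ) : ℝ) =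
      irreducibleCount F n - if n = 1 then 1 else 0 := by
  classical
  set T := ((finite_setOf_natDegree_le F n).subset
    (show {f : F[X] | (f.Monic ∧ Irreducible f) ∧ f.natDegree = n} ⊆ _ from
      fun _ h => h.2.le)).toFinset with hT
  have hmem : ∀ f, f ∈ T ↔ (f.Monic ∧ Irreducible f) ∧ f.natDegree = n := by simp [hT]
  have hc : irreducibleCount F n = T.card := Nat.subtype_card _ hmem
  have heq : {f ∈ irreduciblesUpTo F d | f.natDegree = n} = T.erase X := by
    ext f
    simp only [Finset.mem_filter, mem_irreduciblesUpTo, Finset.mem_erase, hmem]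
    constructor
    · rintro ⟨⟨h1, h2, h3, h4⟩, h5⟩
      exact ⟨h3, ⟨h1, h2⟩, h5⟩
    · rintro ⟨h3, ⟨h1, h2⟩, h5⟩
      exact ⟨⟨h1, h2, h3, by omega⟩, h5⟩
  rw [heq, hc]
  split_ifs with h
  · have : X ∈ T := (hmem X).mpr ⟨⟨monic_X, irreducible_X⟩, by simp [h]⟩
    rw [Finset.card_erase_of_mem this, Nat.cast_sub (Finset.card_pos.mpr ⟨_, this⟩)]
    simp
  · rw [Finset.erase_eq_of_notMem, sub_zero]
    rw [hmem]
    rintro ⟨_, h'⟩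
    exact h (by simpa using h'.symm)

end IrreducibleCount

/-! ### Counting preimages under surjective additive maps -/

section CardPreimage

variable {M N : Type*} [AddCommGroup M] [AddCommGroup N]

/-- All fibres of a surjective additive map have the same size. -/
theorem card_preimage_mul_card {f : M →+ N} (hf : Function.Surjective f) (P : N → Prop) :
    Nat.card {x // P (f x)} * Nat.card N = Nat.card {y // P y} * Nat.card M := by
  choose s hs using hf
  let E : M ≃ N × f.ker :=
    { toFun := fun x => (f x, ⟨x - s (f x), by simp [AddMonoidHom.mem_ker, hs]⟩)
      invFun := fun z => z.2 + s z.1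
      left_inv := fun x => by simp
      right_inv := fun z => by
        have : f z.2 = 0 := z.2.2
        ext <;> simp [hs, this] }
  have h1 : Nat.card {x // P (f x)} = Nat.card {y // P y} * Nat.card f.ker := by
    rw [← Nat.card_prod]
    exact Nat.card_congr ((E.subtypeEquiv (fun x => Iff.rfl)).trans
      (Equiv.prodSubtypeFstEquivSubtypeProd (p := P)))
  have h2 : Nat.card M = Nat.card N * Nat.card f.ker := by
    rw [← Nat.card_prod]
    exact Nat.card_congr E
  rw [h1, h2]
  ring

end CardPreimage

/-! ### Linear maps between cyclic torsion modules -/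

section Cyclic

variable {R : Type*} [CommRing R]

/-- A linear map out of `R / (a)` is the choice of an element killed by `a`. -/
noncomputable def quotientHomEquiv (a : R) (N : Type*) [AddCommGroup N] [Module R N] :
    ((R ⧸ Ideal.span {a}) →ₗ[R] N) ≃ {y : N // a • y = 0} where
  toFun f := ⟨f 1, by
    rw [← map_smul, Algebra.smul_def, mul_one]
    have : algebraMap R (R ⧸ Ideal.span {a}) a = 0 :=
      Ideal.Quotient.eq_zero_iff_mem.mpr (Ideal.mem_span_singleton_self a)
    rw [this, map_zero]⟩
  invFun y := Submodule.liftQSpanSingleton a (LinearMap.toSpanSingleton R N y.1) (by simpa using y.2)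
  left_inv f := by
    refine LinearMap.ext fun x => ?_
    obtain ⟨r, rfl⟩ := Ideal.Quotient.mk_surjective x
    change r • f 1 = _
    rw [← map_smul, Algebra.smul_def, mul_one]
    rfl
  right_inv y := by
    refine Subtype.ext ?_
    change (1 : R) • y.1 = y.1
    rw [one_smul]

theorem quotientHomEquiv_symm_apply_one {a : R} {N : Type*} [AddCommGroup N] [Module R N]
    (y : {y : N // a • y = 0}) : (quotientHomEquiv a N).symm y 1 = y.1 :=
  congrArg Subtype.val ((quotientHomEquiv a N).apply_symm_apply y)

theorem smul_mk_eq_zero_iff {a b r : R} :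
    b • (Ideal.Quotient.mk (Ideal.span {a}) r) = 0 ↔ a ∣ b * r := by
  rw [← Ideal.Quotient.eq_zero_iff_dvd, map_mul, Algebra.smul_def]
  rfl

theorem eq_zero_of_isCoprime_smul {M : Type*} [AddCommGroup M] [Module R M] {a b : R}
    (h : IsCoprime a b) {x : M} (ha : a • x = 0) (hb : b • x = 0) : x = 0 := by
  obtain ⟨u, v, huv⟩ := h
  rw [← one_smul R x, ← huv, add_smul, mul_smul, mul_smul, ha, hb]
  simp

theorem smul_quotient_span_self (a : R) (x : R ⧸ Ideal.span {a}) : a • x = 0 := by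
  obtain ⟨r, rfl⟩ := Ideal.Quotient.mk_surjective x
  rw [smul_mk_eq_zero_iff]
  exact dvd_mul_right a r

variable [IsDomain R] {p : R} {Q : ℕ}

/-- The `p ^ b`-torsion of `R / (p ^ a)` is the kernel of `R / (p ^ a) → R / (p ^ (a - b))`. -/
theorem card_torsion_pow_quotient_pow (hp : p ≠ 0) (hQ0 : Q ≠ 0)
    (hQ : ∀ k, Nat.card (R ⧸ Ideal.span {p ^ k}) = Q ^ k) (a b : ℕ) :
    Nat.card {y : R ⧸ Ideal.span {p ^ a} // p ^ b • y = 0} = Q ^ min a b := by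
  have hle : Ideal.span {p ^ a} ≤ Ideal.span {p ^ (a - b)} :=
    Ideal.span_singleton_le_span_singleton.mpr (pow_dvd_pow p (Nat.sub_le a b))
  have h1 := card_preimage_mul_card (f := (Ideal.Quotient.factor hle).toAddMonoidHom)
    (Ideal.Quotient.factor_surjective hle) (fun y => y = 0)
  have h2 : ∀ y : R ⧸ Ideal.span {p ^ a}, (Ideal.Quotient.factor hle).toAddMonoidHom y = 0 ↔
      p ^ b • y = 0 := by
    intro y
    obtain ⟨r, rfl⟩ := Ideal.Quotient.mk_surjective y
    rw [smul_mk_eq_zero_iff]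
    change Ideal.Quotient.mk (Ideal.span {p ^ (a - b)}) r = 0 ↔ _
    rw [Ideal.Quotient.eq_zero_iff_dvd]
    rcases le_total b a with hba | hab
    · rw [← Nat.add_sub_cancel' hba, pow_add, Nat.add_sub_cancel_left,
        mul_dvd_mul_iff_left (pow_ne_zero b hp)]
    · simp [Nat.sub_eq_zero_of_le hab, (pow_dvd_pow p hab).mul_right r]
  have hu : Nat.card {y : R ⧸ Ideal.span {p ^ (a - b)} // y = 0} = 1 := Nat.card_unique
  rw [Nat.card_congr (Equiv.subtypeEquivRight h2), hu, one_mul, hQ, hQ] at h1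
  have h3 : Q ^ (a - b) ≠ 0 := pow_ne_zero _ hQ0
  refine Nat.eq_of_mul_eq_mul_right (Nat.pos_of_ne_zero h3) (h1.trans ?_)
  rw [← pow_add]
  congr 1
  omega

end Cyclic

/-! ### Invertible matrices over a finite field -/

/-- The order of `GL(m, Q)`. -/
def orderGL (Q m : ℕ) : ℕ := ∏ i : Fin m, (Q ^ m - Q ^ (i : ℕ))

theorem card_isUnit_det {K : Type*} [CommRing K] [Finite K] (hK : IsField K) {n : Type*} [Fintype n]
    [DecidableEq n] :
    Nat.card {A : Matrix n n K // IsUnit A.det} = orderGL (Nat.card K) (Fintype.card n) := by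
  let := hK.toField
  have := Fintype.ofFinite K
  rw [orderGL, Nat.card_eq_fintype_card (α := K), ← Matrix.card_GL_field]
  have e1 : {A : Matrix n n K // IsUnit A.det} ≃ (Matrix n n K)ˣ :=
    { toFun := fun A => ((Matrix.isUnit_iff_isUnit_det A.1).mpr A.2).unit
      invFun := fun u => ⟨u, (Matrix.isUnit_iff_isUnit_det _).mp u.isUnit⟩
      left_inv := fun A => rfl
      right_inv := fun u => Units.ext rfl }
  exact Nat.card_congr (e1.trans (Units.mapEquiv
    (Matrix.reindexAlgEquiv K K (Fintype.equivFin n)).toMulEquiv).toEquiv)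

/-! ### Automorphisms of a finite primary module -/

section Primary

variable {R : Type*} [CommRing R] {ι : Type*} [Fintype ι] [DecidableEq ι]

/-- The module `∏ i, R / (p ^ e i)`. -/
abbrev PrimaryModule (p : R) (e : ι → ℕ) : Type _ := ∀ i, R ⧸ Ideal.span {p ^ e i}

/-- The endomorphisms of `∏ i, R / (p ^ e i)`, as matrices of maps between the factors. -/
noncomputable def primaryEndEquiv (p : R) (e : ι → ℕ) :
    (PrimaryModule p e →ₗ[R] PrimaryModule p e) ≃
      (∀ j i, (R ⧸ Ideal.span {p ^ e j}) →ₗ[R] (R ⧸ Ideal.span {p ^ e i})) where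
  toFun φ j i := LinearMap.proj i ∘ₗ φ ∘ₗ LinearMap.single R (fun i => R ⧸ Ideal.span {p ^ e i}) j
  invFun A := LinearMap.pi fun i => ∑ j, A j i ∘ₗ LinearMap.proj j
  left_inv φ := by
    refine LinearMap.pi_ext fun j x => ?_
    funext i
    simp only [LinearMap.pi_apply, LinearMap.sum_apply, LinearMap.comp_apply, LinearMap.proj_apply]
    rw [Finset.sum_eq_single j]
    · simp
    · intro k _ hk
      simp [Pi.single_eq_of_ne hk]
    · simp
  right_inv A := by
    funext j i
    refine LinearMap.ext fun x => ?_
    simp only [LinearMap.comp_apply, LinearMap.proj_apply, LinearMap.pi_apply, LinearMap.sum_apply,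
      LinearMap.single_apply]
    rw [Finset.sum_eq_single j]
    · simp
    · intro k _ hk
      simp [Pi.single_eq_of_ne hk]
    · simp

variable {p : R} {e : ι → ℕ}

/-- The projection `R / (p ^ a) → R / (p)`, for `a ≠ 0`. -/
def residueMap {a : ℕ} (ha : a ≠ 0) : (R ⧸ Ideal.span {p ^ a}) →+* R ⧸ Ideal.span {p} :=
  Ideal.Quotient.factor (Ideal.span_singleton_le_span_singleton.mpr (dvd_pow_self p ha))

theorem residueMap_surjective {a : ℕ} (ha : a ≠ 0) :
    Function.Surjective (residueMap (p := p) ha) :=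
  Ideal.Quotient.factor_surjective _

theorem residueMap_smul {a : ℕ} (ha : a ≠ 0) (r : R) (x : R ⧸ Ideal.span {p ^ a}) :
    residueMap ha (r • x) = Ideal.Quotient.mk _ r * residueMap ha x := by
  rw [Algebra.smul_def, map_mul]
  rfl

theorem exists_smul_of_residueMap_eq_zero {a : ℕ} (ha : a ≠ 0) {x : R ⧸ Ideal.span {p ^ a}}
    (hx : residueMap ha x = 0) : ∃ y, x = p • y := by
  obtain ⟨r, rfl⟩ := Ideal.Quotient.mk_surjective x
  obtain ⟨s, rfl⟩ := (Ideal.Quotient.eq_zero_iff_dvd p r).mp hx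
  exact ⟨Ideal.Quotient.mk _ s, by rw [map_mul, Algebra.smul_def]; rfl⟩

/-- The matrix of the map induced on `M / p M` by an endomorphism of `M = ∏ i, R / (p ^ e i)`. -/
def reduction (he : ∀ i, e i ≠ 0) (φ : PrimaryModule p e →ₗ[R] PrimaryModule p e) :
    Matrix ι ι (R ⧸ Ideal.span {p}) :=
  Matrix.of fun i j => residueMap (he i) (φ (Pi.single j 1) i)

theorem reduction_mulVec (he : ∀ i, e i ≠ 0) (φ : PrimaryModule p e →ₗ[R] PrimaryModule p e)
    (x : PrimaryModule p e) :
    (reduction he φ).mulVec (fun j => residueMap (he j) (x j)) =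
      fun i => residueMap (he i) (φ x i) := by
  choose r hr using fun j => Ideal.Quotient.mk_surjective (x j)
  have hx : x = ∑ j, r j • (Pi.single j 1 : PrimaryModule p e) := by
    funext k
    rw [Finset.sum_apply, Finset.sum_eq_single k]
    · rw [Pi.smul_apply, Pi.single_eq_same, Algebra.smul_def, mul_one, ← hr k]
      rfl
    · intro j _ hj
      rw [Pi.smul_apply, Pi.single_eq_of_ne' hj, smul_zero]
    · simp
  funext i
  conv_rhs => rw [hx]
  rw [map_sum, Finset.sum_apply, map_sum, Matrix.mulVec, dotProduct]
  refine Finset.sum_congr rfl fun j _ => ?_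
  rw [map_smul, Pi.smul_apply, residueMap_smul, mul_comm, ← hr j]
  rfl

theorem bijective_of_isUnit_det_reduction [Finite (PrimaryModule p e)] (he : ∀ i, e i ≠ 0)
    {φ : PrimaryModule p e →ₗ[R] PrimaryModule p e} (h : IsUnit (reduction he φ).det) :
    Function.Bijective φ := by
  have hsurj : Function.Surjective (reduction he φ).mulVec :=
    Matrix.mulVec_surjective_iff_isUnit.mpr ((Matrix.isUnit_iff_isUnit_det _).mpr h)
  -- Nakayama's argument: `φ` is surjective modulo `p`, hence modulo every power of `p`
  have step : ∀ x, ∃ y z, x = φ y + p • z := by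
    intro x
    obtain ⟨v, hv⟩ := hsurj fun i => residueMap (he i) (x i)
    choose y hy using fun j => residueMap_surjective (he j) (v j)
    have h1 := reduction_mulVec he φ y
    simp only [hy] at h1
    rw [show (fun j => v j) = v from rfl, hv] at h1
    have h2 : ∀ i, ∃ z, x i - φ y i = p • z := fun i =>
      exists_smul_of_residueMap_eq_zero (he i) (by rw [map_sub, congrFun h1 i, sub_self])
    choose z hz using h2
    exact ⟨y, z, by funext i; simp [← hz i]⟩
  have iter : ∀ (k : ℕ) x, ∃ y z, x = φ y + p ^ k • z := by
    intro k
    induction k with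
    | zero => exact fun x => ⟨0, x, by simp⟩
    | succ k ih =>
      intro x
      obtain ⟨y, z, rfl⟩ := ih x
      obtain ⟨y', z', rfl⟩ := step z
      exact ⟨y + p ^ k • y', z', by simp [pow_succ, mul_smul, add_assoc]⟩
  have hs : Function.Surjective φ := by
    intro x
    obtain ⟨y, z, hx⟩ := iter (∑ i, e i) x
    refine ⟨y, ?_⟩
    have hz : p ^ (∑ i, e i) • z = 0 := by
      funext i
      rw [Pi.smul_apply, ← Nat.sub_add_cancel (Finset.single_le_sum (f := e)
        (fun _ _ => Nat.zero_le _) (Finset.mem_univ i)), pow_add, mul_smul,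
        smul_quotient_span_self, smul_zero, Pi.zero_apply]
    rw [hx, hz, add_zero]
  exact ⟨Finite.injective_iff_surjective.mpr hs, hs⟩

theorem isUnit_det_reduction_of_bijective (he : ∀ i, e i ≠ 0)
    {φ : PrimaryModule p e →ₗ[R] PrimaryModule p e} (h : Function.Bijective φ) :
    IsUnit (reduction he φ).det := by
  rw [← Matrix.isUnit_iff_isUnit_det, ← Matrix.mulVec_surjective_iff_isUnit]
  intro v
  choose x hx using fun j => residueMap_surjective (he j) (v j)
  obtain ⟨y, rfl⟩ := h.2 x
  exact ⟨_, (reduction_mulVec he φ y).trans (funext hx)⟩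

/-- A map from `R / (p ^ b)` to `R / (p ^ a)` with `b < a` has image in the multiples of `p`, so the
reduction of an endomorphism is block triangular. -/
theorem reduction_blockTriangular {R ι : Type*} [CommRing R] [IsDomain R] [DecidableEq ι] {p : R}
    {e : ι → ℕ} (hp : p ≠ 0) (he : ∀ i, e i ≠ 0)
    (φ : PrimaryModule p e →ₗ[R] PrimaryModule p e) : (reduction he φ).BlockTriangular e := by
  intro i j hij
  obtain ⟨r, hr⟩ := Ideal.Quotient.mk_surjective (φ (Pi.single j 1) i)
  have h1 : p ^ e j • φ (Pi.single j 1) i = 0 := by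
    rw [← Pi.smul_apply, ← map_smul, ← Pi.single_smul, smul_quotient_span_self, Pi.single_zero,
      map_zero, Pi.zero_apply]
  rw [← hr, smul_mk_eq_zero_iff, ← Nat.add_sub_cancel' hij.le, pow_add,
    mul_dvd_mul_iff_left (pow_ne_zero _ hp)] at h1
  change residueMap (he i) (φ (Pi.single j 1) i) = 0
  rw [← hr]
  exact (Ideal.Quotient.eq_zero_iff_dvd p r).mpr
    ((dvd_pow_self p (Nat.sub_ne_zero_of_lt hij)).trans h1)

/-- The diagonal blocks of the reduction of an endomorphism. -/
def diagonalBlocks (he : ∀ i, e i ≠ 0) : (PrimaryModule p e →ₗ[R] PrimaryModule p e) →+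
    ∀ v : Finset.univ.image e, Matrix {i // e i = v} {i // e i = v} (R ⧸ Ideal.span {p}) where
  toFun φ v := (reduction he φ).toSquareBlock e v
  map_zero' := by
    funext v
    ext i j
    simp [Matrix.toSquareBlock_def, reduction]
  map_add' φ ψ := by
    funext v
    ext i j
    simp [Matrix.toSquareBlock_def, reduction]

theorem diagonalBlocks_surjective (he : ∀ i, e i ≠ 0) :
    Function.Surjective (diagonalBlocks (p := p) he) := by
  intro B
  choose s hs using fun i => residueMap_surjective (p := p) (he i)
  have hmem : ∀ i, e i ∈ Finset.univ.image e := fun i => Finset.mem_image_of_mem e (Finset.mem_univ i)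
  -- the entries outside the diagonal blocks are taken to be zero; inside a block every entry is
  -- allowed, as `p ^ e j` annihilates `R / (p ^ e i)` when `e i = e j`
  let b : ∀ j i, {y : R ⧸ Ideal.span {p ^ e i} // p ^ e j • y = 0} := fun j i =>
    if h : e j = e i then ⟨s i (B ⟨e i, hmem i⟩ ⟨i, rfl⟩ ⟨j, h⟩), by
      rw [h, smul_quotient_span_self]⟩ else ⟨0, smul_zero _⟩
  refine ⟨(primaryEndEquiv p e).symm fun j i => (quotientHomEquiv _ _).symm (b j i), ?_⟩
  set φ := (primaryEndEquiv p e).symm fun j i => (quotientHomEquiv _ _).symm (b j i) with hφ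
  have key : ∀ i j, φ (Pi.single j 1) i = (b j i).1 := by
    intro i j
    have h1 : primaryEndEquiv p e φ j i 1 = (quotientHomEquiv _ _).symm (b j i) 1 := by
      rw [hφ, Equiv.apply_symm_apply]
    rw [quotientHomEquiv_symm_apply_one] at h1
    exact h1
  funext v
  ext ⟨i, hi⟩ ⟨j, hj⟩
  obtain ⟨v, hv⟩ := v
  change e i = v at hi
  change e j = v at hj
  subst hi
  change residueMap (he i) (φ (Pi.single j 1) i) = _
  rw [key, show b j i = _ from dif_pos hj, hs]

/-- The number of automorphisms of `∏ i, R / (p ^ e i)`, where `Q = |R / (p)|`: an endomorphism is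
invertible exactly when the diagonal blocks of its reduction are, and these blocks are
equidistributed. -/
theorem card_primaryModule_equiv_mul [IsDomain R] (hp : Prime p) {Q : ℕ} (hQ0 : Q ≠ 0)
    (hQ : ∀ k, Nat.card (R ⧸ Ideal.span {p ^ k}) = Q ^ k) (he : ∀ i, e i ≠ 0) :
    Nat.card (PrimaryModule p e ≃ₗ[R] PrimaryModule p e) *
        ∏ v ∈ Finset.univ.image e, Q ^ (Fintype.card {i // e i = v} ^ 2) =
      (∏ v ∈ Finset.univ.image e, orderGL Q (Fintype.card {i // e i = v})) *
        ∏ j, ∏ i, Q ^ min (e i) (e j) := by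
  have hfin : ∀ k, Finite (R ⧸ Ideal.span {p ^ k}) := fun k =>
    Nat.finite_of_card_ne_zero (by rw [hQ]; exact pow_ne_zero _ hQ0)
  have hK : Nat.card (R ⧸ Ideal.span {p}) = Q := by simpa using hQ 1
  have : Finite (R ⧸ Ideal.span {p}) := Nat.finite_of_card_ne_zero (by rwa [hK])
  have : IsDomain (R ⧸ Ideal.span {p}) := by
    rw [Ideal.Quotient.isDomain_iff_prime, Ideal.span_singleton_prime hp.ne_zero]
    exact hp
  have hfield : IsField (R ⧸ Ideal.span {p}) := Finite.isField_of_domain _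
  have h1 := card_preimage_mul_card (diagonalBlocks_surjective (p := p) he)
    (fun B => ∀ v, IsUnit (B v).det)
  have h2 : ∀ φ, (∀ v, IsUnit (diagonalBlocks (p := p) he φ v).det) ↔ Function.Bijective φ := by
    intro φ
    have h3 : IsUnit (reduction he φ).det ↔ Function.Bijective φ :=
      ⟨bijective_of_isUnit_det_reduction he, isUnit_det_reduction_of_bijective he⟩
    rw [← h3, (reduction_blockTriangular hp.ne_zero he φ).det, IsUnit.prod_iff]
    exact ⟨fun h v hv => h ⟨v, hv⟩, fun h v => h v v.2⟩
  have e1 : {φ : PrimaryModule p e →ₗ[R] PrimaryModule p e // Function.Bijective φ} ≃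
      (PrimaryModule p e ≃ₗ[R] PrimaryModule p e) :=
    { toFun := fun φ => LinearEquiv.ofBijective φ.1 φ.2
      invFun := fun ψ => ⟨ψ.toLinearMap, ψ.bijective⟩
      left_inv := fun φ => rfl
      right_inv := fun ψ => LinearEquiv.ext fun x => rfl }
  have e2 : {B : ∀ v : Finset.univ.image e,
      Matrix {i // e i = v} {i // e i = v} (R ⧸ Ideal.span {p}) // ∀ v, IsUnit (B v).det} ≃
      ∀ v : Finset.univ.image e,
        {A : Matrix {i // e i = v} {i // e i = v} (R ⧸ Ideal.span {p}) // IsUnit A.det} :=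
    Equiv.subtypePiEquivPi (p := fun (v : Finset.univ.image e)
      (A : Matrix {i // e i = v} {i // e i = v} (R ⧸ Ideal.span {p})) => IsUnit A.det)
  rw [Nat.card_congr ((Equiv.subtypeEquivRight h2).trans e1), Nat.card_congr e2,
    Nat.card_congr (primaryEndEquiv p e), Nat.card_pi, Nat.card_pi, Nat.card_pi] at h1
  simp only [Nat.card_pi, Nat.card_congr (quotientHomEquiv _ _),
    card_torsion_pow_quotient_pow hp.ne_zero hQ0 hQ, card_isUnit_det hfield, hK] at h1
  rw [← Finset.prod_coe_sort (Finset.univ.image e) fun v => Q ^ (Fintype.card {i // e i = v} ^ 2),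
    ← Finset.prod_coe_sort (Finset.univ.image e) fun v => orderGL Q (Fintype.card {i // e i = v}),
    ← h1]
  congr 1
  refine Finset.prod_congr rfl fun v _ => ?_
  rw [Matrix, Nat.card_pi]
  simp only [Nat.card_pi, hK, Finset.prod_const, Finset.card_univ]
  rw [← pow_mul, sq]

end Primary

/-! ### The centralizer polynomial of a multiset of parts -/

/-- `k(μ)` for a multiset `μ` of parts, possibly empty. -/
def centralizerExponent (μ : Multiset ℕ) : ℕ :=
  2 * ∑ i ∈ μ.toFinset, ∑ j ∈ μ.toFinset with i < j, i * μ.count i * μ.count j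
    + ∑ i ∈ μ.toFinset, (i - 1) * μ.count i ^ 2

/-- `C_{GL, μ}(q)` for a multiset `μ` of parts, possibly empty. -/
noncomputable def centralizerPoly (μ : Multiset ℕ) : ℤ[X] :=
  X ^ centralizerExponent μ * ∏ i ∈ μ.toFinset, orderGLPoly (μ.count i)

theorem centralizerPoly_zero : centralizerPoly 0 = 1 := by
  simp [centralizerPoly, centralizerExponent]

theorem aeval_orderGLPoly {Q : ℕ} (hQ : Q ≠ 0) (m : ℕ) :
    aeval (Q : ℝ) (orderGLPoly m) = orderGL Q m := by
  have h1 : ∀ i : Fin m, (((Q ^ m - Q ^ (i : ℕ) : ℕ)) : ℝ) =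
      (Q : ℝ) ^ (i : ℕ) * ((Q : ℝ) ^ (m - i) - 1) := by
    intro i
    rw [Nat.cast_sub (Nat.pow_le_pow_right (Nat.pos_of_ne_zero hQ) i.2.le), mul_sub, ← pow_add,
      Nat.add_sub_cancel' i.2.le]
    push_cast
    ring
  rw [orderGL, Nat.cast_prod, Finset.prod_congr rfl fun i _ => h1 i, Finset.prod_mul_distrib,
    Finset.prod_pow_eq_pow_sum, Fin.sum_univ_eq_sum_range (fun i => i), Finset.sum_range_id,
    ← Nat.choose_two_right,
    Fin.prod_univ_eq_prod_range (fun i => (Q : ℝ) ^ (m - i) - 1) m, orderGLPoly]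
  simp only [map_mul, map_pow, aeval_X, map_prod, map_sub, map_one]
  congr 1
  rw [← Finset.prod_range_reflect, ← Finset.Ico_add_one_right_eq_Icc, Finset.prod_Ico_eq_prod_range]
  refine Finset.prod_congr rfl fun i hi => ?_
  rw [Finset.mem_range] at hi
  congr 2
  omega

theorem sum_toType {M : Type*} [AddCommMonoid M] (μ : Multiset ℕ) (g : ℕ → M) :
    ∑ i : μ, g i.1 = ∑ v ∈ μ.toFinset, μ.count v • g v := by
  rw [← Finset.sum_multiset_map_count, Finset.sum_eq_multiset_sum]
  conv_rhs => rw [← Multiset.map_univ_coe μ, Multiset.map_map]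
  rfl

theorem card_toType_fiber (μ : Multiset ℕ) (v : ℕ) :
    Fintype.card {i : μ // i.1 = v} = μ.count v := by
  conv_rhs => rw [← Multiset.map_univ_coe μ]
  rw [Multiset.count_map, Fintype.card_subtype, Finset.card, Finset.filter_val]
  simp only [eq_comm]

theorem image_toType (μ : Multiset ℕ) :
    Finset.univ.image (fun i : μ => i.1) = μ.toFinset := by
  conv_rhs => rw [← Multiset.map_univ_coe μ]
  rfl

/-- `∑ i j, min i j`, over pairs of parts, exceeds the exponent `k(μ)` by `∑ m_i ^ 2`. -/
theorem sum_min_toType {μ : Multiset ℕ} (hμ : 0 ∉ μ) :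
    ∑ j : μ, ∑ i : μ, min i.1 j.1 =
      centralizerExponent μ + ∑ v ∈ μ.toFinset, μ.count v ^ 2 := by
  have h1 : ∑ j : μ, ∑ i : μ, min i.1 j.1 =
      ∑ j ∈ μ.toFinset, ∑ i ∈ μ.toFinset, μ.count j * (μ.count i * min i j) := by
    rw [sum_toType μ fun j => ∑ i : μ, min i.1 j]
    refine Finset.sum_congr rfl fun j _ => ?_
    rw [sum_toType μ fun i => min i j, smul_eq_mul, Finset.mul_sum]
    rfl
  have h2 : ∀ j ∈ μ.toFinset, ∑ i ∈ μ.toFinset, μ.count j * (μ.count i * min i j) =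
      (∑ i ∈ μ.toFinset with i < j, i * μ.count i * μ.count j) +
      ((∑ i ∈ μ.toFinset with j < i, j * μ.count j * μ.count i) + j * μ.count j ^ 2) := by
    intro j hj
    rw [Finset.sum_filter, Finset.sum_filter,
      ← Finset.sum_ite_eq_of_mem' μ.toFinset j (fun j => j * μ.count j ^ 2) hj,
      ← Finset.sum_add_distrib, ← Finset.sum_add_distrib]
    refine Finset.sum_congr rfl fun i _ => ?_
    rcases lt_trichotomy i j with h | h | h
    · simp [h, h.le, h.ne, h.not_gt]; ring
    · subst h; simp; ring
    · simp [h, h.le, h.ne', h.not_gt]; ring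
  have h3 : ∑ j ∈ μ.toFinset, ∑ i ∈ μ.toFinset with i < j, i * μ.count i * μ.count j =
      ∑ j ∈ μ.toFinset, ∑ i ∈ μ.toFinset with j < i, j * μ.count j * μ.count i := by
    simp only [Finset.sum_filter]
    exact Finset.sum_comm
  have h4 : ∑ i ∈ μ.toFinset, i * μ.count i ^ 2 =
      ∑ i ∈ μ.toFinset, (i - 1) * μ.count i ^ 2 + ∑ i ∈ μ.toFinset, μ.count i ^ 2 := by
    rw [← Finset.sum_add_distrib]
    refine Finset.sum_congr rfl fun i hi => ?_
    obtain ⟨k, rfl⟩ : ∃ k, i = k + 1 := Nat.exists_eq_succ_of_ne_zero (by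
      rintro rfl
      exact hμ (Multiset.mem_toFinset.mp hi))
    rw [Nat.add_sub_cancel]
    ring
  rw [h1, Finset.sum_congr rfl h2, Finset.sum_add_distrib, Finset.sum_add_distrib, h3, h4,
    centralizerExponent]
  ring

theorem card_primaryModule_equiv {R : Type*} [CommRing R] [IsDomain R] {p : R} (hp : Prime p)
    {Q : ℕ} (hQ0 : Q ≠ 0) (hQ : ∀ k, Nat.card (R ⧸ Ideal.span {p ^ k}) = Q ^ k) {μ : Multiset ℕ}
    (hμ : 0 ∉ μ) :
    (Nat.card (PrimaryModule p (fun i : μ => i.1) ≃ₗ[R] PrimaryModule p (fun i : μ => i.1)) : ℝ) =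
      aeval (Q : ℝ) (centralizerPoly μ) := by
  classical
  have h1 := card_primaryModule_equiv_mul hp hQ0 hQ (e := fun i : μ => i.1)
    (fun i h => hμ (h ▸ Multiset.coe_mem))
  simp only [card_toType_fiber, image_toType, Finset.prod_pow_eq_pow_sum] at h1
  rw [sum_min_toType hμ, pow_add, ← mul_assoc] at h1
  have h2 := Nat.eq_of_mul_eq_mul_right (Nat.pos_of_ne_zero (pow_ne_zero _ hQ0)) h1
  rw [h2, centralizerPoly]
  simp only [Nat.cast_mul, Nat.cast_prod, Nat.cast_pow, map_mul, map_pow, aeval_X, map_prod,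
    aeval_orderGLPoly hQ0]
  rw [mul_comm]

/-! ### Degrees -/

theorem monic_orderGLPoly (m : ℕ) : (orderGLPoly m).Monic :=
  (monic_X_pow _).mul (monic_prod_of_monic _ _ fun l hl =>
    monic_X_pow_sub_C 1 (by rw [Finset.mem_Icc] at hl; omega))

theorem natDegree_orderGLPoly (m : ℕ) :
    (orderGLPoly m).natDegree = m.choose 2 + ∑ l ∈ Finset.Icc 1 m, l := by
  have h : ∀ l ∈ Finset.Icc 1 m, (X ^ l - 1 : ℤ[X]).Monic := fun l hl =>
    monic_X_pow_sub_C 1 (by rw [Finset.mem_Icc] at hl; omega)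
  rw [orderGLPoly, (monic_X_pow _).natDegree_mul (monic_prod_of_monic _ _ h), natDegree_X_pow,
    natDegree_prod_of_monic _ _ h]
  congr 1
  exact Finset.sum_congr rfl fun l _ => natDegree_X_pow_sub_C (r := (1 : ℤ))

theorem natDegree_centralizerPoly (μ : Multiset ℕ) : (centralizerPoly μ).natDegree =
    centralizerExponent μ +
      ∑ i ∈ μ.toFinset, ((μ.count i).choose 2 + ∑ l ∈ Finset.Icc 1 (μ.count i), l) := by
  rw [centralizerPoly, (monic_X_pow _).natDegree_mul
    (monic_prod_of_monic _ _ fun i _ => monic_orderGLPoly _), natDegree_X_pow,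
    natDegree_prod_of_monic _ _ fun i _ => monic_orderGLPoly _]
  simp only [natDegree_orderGLPoly]

theorem natDegree_centralizerPoly_pos {μ : Multiset ℕ} (hμ : μ ≠ 0) :
    0 < (centralizerPoly μ).natDegree := by
  obtain ⟨i, hi⟩ := Multiset.exists_mem_of_ne_zero hμ
  rw [natDegree_centralizerPoly]
  have h1 : 1 ≤ ∑ l ∈ Finset.Icc 1 (μ.count i), l :=
    Finset.single_le_sum (f := fun l => l) (fun _ _ => Nat.zero_le _)
      (Finset.mem_Icc.mpr ⟨le_rfl, Multiset.one_le_count_iff_mem.mpr hi⟩)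
  have h2 := Finset.single_le_sum
    (f := fun i => (μ.count i).choose 2 + ∑ l ∈ Finset.Icc 1 (μ.count i), l)
    (fun _ _ => Nat.zero_le _) (Multiset.mem_toFinset.mpr hi)
  omega

namespace HasExpansion

variable {I : Type*} {q : I → ℝ}

theorem inv_pow_sub_one (hq : ∀ i, 1 < q i) {n l : ℕ} (hn : n ≠ 0) (hl : l ≠ 0) :
    HasExpansion q (n * l : ℕ) (fun i => ((q i ^ n) ^ l - 1)⁻¹) := by
  have h1 := (inv_pow (q := q) (n * l)).mul (inv_one_sub_inv_pow hq (mul_ne_zero hn hl))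
  rw [add_zero] at h1
  convert h1 using 2 with i
  have h0 : q i ≠ 0 := (one_pos.trans (hq i)).ne'
  have h2 : ((q i ^ n) ^ l - 1) = q i ^ (n * l) * (1 - (q i)⁻¹ ^ (n * l)) := by
    rw [_root_.inv_pow, ← pow_mul]
    field_simp
  rw [h2, mul_inv, _root_.inv_pow]

/-- The reciprocal of `C_{GL, μ}(q ^ n)` is `q ^ (- n Δ(μ))` times a power series in `q⁻¹`. -/
theorem inv_centralizerPoly (hq : ∀ i, 1 < q i) {n : ℕ} (hn : n ≠ 0) (μ : Multiset ℕ) :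
    HasExpansion q (n * (centralizerPoly μ).natDegree : ℕ)
      (fun i => (aeval (q i ^ n) (centralizerPoly μ))⁻¹) := by
  have hX : ∀ a : ℕ, HasExpansion q (n * a : ℕ) (fun i => ((q i ^ n) ^ a)⁻¹) := by
    intro a
    simpa only [_root_.inv_pow, ← pow_mul] using inv_pow (q := q) (n * a)
  have hGL : ∀ m : ℕ, HasExpansion q (n * (orderGLPoly m).natDegree : ℕ)
      (fun i => (aeval (q i ^ n) (orderGLPoly m))⁻¹) := by
    intro m
    rw [natDegree_orderGLPoly, mul_add, Finset.mul_sum, Nat.cast_add, Nat.cast_sum]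
    have := (hX (m.choose 2)).mul (prod (Finset.Icc 1 m)
      fun l hl => inv_pow_sub_one (l := l) hq hn (by rw [Finset.mem_Icc] at hl; omega))
    simpa only [orderGLPoly, map_mul, map_pow, aeval_X, map_prod, map_sub, map_one, mul_inv,
      Finset.prod_inv_distrib] using this
  rw [natDegree_centralizerPoly, mul_add, Finset.mul_sum, Nat.cast_add, Nat.cast_sum]
  have := (hX (centralizerExponent μ)).mul (prod μ.toFinset fun i _ => hGL (μ.count i))
  simpa only [centralizerPoly, map_mul, map_pow, aeval_X, map_prod, mul_inv,
    Finset.prod_inv_distrib, natDegree_orderGLPoly] using this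

end HasExpansion

/-! ### Products of modules with coprime annihilators -/

section CoprimeProduct

variable {R κ : Type*} [CommRing R] [Fintype κ] [DecidableEq κ] {M : κ → Type*}
  [∀ k, AddCommGroup (M k)] [∀ k, Module R (M k)] {a : κ → R}

/-- Endomorphisms of a product of modules with pairwise coprime annihilators are diagonal. -/
theorem linearMap_pi_apply_of_coprime (ha : ∀ k (x : M k), a k • x = 0)
    (hc : Pairwise fun k l => IsCoprime (a k) (a l)) (φ : (∀ k, M k) →ₗ[R] ∀ k, M k)
    (x : ∀ k, M k) (k : κ) : φ x k = φ (Pi.single k (x k)) k := by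
  rw [← sub_eq_zero, ← Pi.sub_apply, ← map_sub]
  have h1 : (∏ l ∈ Finset.univ.erase k, a l) • (x - Pi.single k (x k)) = 0 := by
    funext l
    rw [Pi.smul_apply, Pi.zero_apply, Pi.sub_apply]
    rcases eq_or_ne l k with rfl | hl
    · simp
    · rw [Pi.single_eq_of_ne hl, sub_zero, ← Finset.prod_erase_mul _ _
        (Finset.mem_erase.mpr ⟨hl, Finset.mem_univ l⟩), mul_smul, ha, smul_zero]
  refine eq_zero_of_isCoprime_smul (a := a k) (b := ∏ l ∈ Finset.univ.erase k, a l)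
    (IsCoprime.prod_right fun l hl => hc (Finset.ne_of_mem_erase hl).symm) (ha k _) ?_
  rw [← Pi.smul_apply, ← map_smul, h1, map_zero, Pi.zero_apply]

theorem card_pi_equiv_of_coprime (ha : ∀ k (x : M k), a k • x = 0)
    (hc : Pairwise fun k l => IsCoprime (a k) (a l)) :
    Nat.card ((∀ k, M k) ≃ₗ[R] ∀ k, M k) = ∏ k, Nat.card (M k ≃ₗ[R] M k) := by
  rw [← Nat.card_pi]
  refine (Nat.card_eq_of_bijective
    (fun ψ : ∀ k, M k ≃ₗ[R] M k => LinearEquiv.piCongrRight ψ) ⟨?_, ?_⟩).symm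
  · intro ψ ψ' h
    funext k
    refine LinearEquiv.ext fun x => ?_
    have h1 := congrFun (LinearEquiv.congr_fun h (Pi.single k x)) k
    simpa using h1
  · intro φ
    have key : ∀ (φ : (∀ k, M k) ≃ₗ[R] ∀ k, M k) (x : ∀ k, M k) (k : κ),
        φ x k = φ (Pi.single k (x k)) k := fun φ =>
      linearMap_pi_apply_of_coprime ha hc φ.toLinearMap
    refine ⟨fun k => LinearEquiv.ofLinearMap
      (LinearMap.proj k ∘ₗ φ.toLinearMap ∘ₗ LinearMap.single R M k)
      (LinearMap.proj k ∘ₗ φ.symm.toLinearMap ∘ₗ LinearMap.single R M k) ?_ ?_, ?_⟩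
    · refine LinearMap.ext fun x => ?_
      have := key φ (φ.symm (Pi.single k x)) k
      simpa using this.symm
    · refine LinearMap.ext fun x => ?_
      have := key φ.symm (φ (Pi.single k x)) k
      simpa using this.symm
    · refine LinearEquiv.ext fun x => funext fun k => ?_
      exact (key φ x k).symm

end CoprimeProduct

/-! ### Multisets and families -/

theorem exists_equiv_of_card_fiber_eq {α β γ : Type*} [Finite α] [Finite β] {u : α → γ} {v : β → γ}
    (h : ∀ c, Nat.card {a // u a = c} = Nat.card {b // v b = c}) :
    ∃ σ : α ≃ β, ∀ a, v (σ a) = u a := by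
  let ε : ∀ c, {a // u a = c} ≃ {b // v b = c} := fun c => (Finite.card_eq.mp (h c)).some
  refine ⟨(Equiv.sigmaFiberEquiv u).symm.trans ((Equiv.sigmaCongrRight ε).trans
    (Equiv.sigmaFiberEquiv v)), fun a => ?_⟩
  exact (ε (u a) ⟨a, rfl⟩).2

/-- The second difference of `k ↦ ∑ a ∈ s, min a k` is minus the multiplicity. -/
theorem count_add_sum_min (s : Multiset ℕ) (k : ℕ) :
    (s.map (min · (k + 2))).sum + s.count (k + 1) + (s.map (min · k)).sum =
      2 * (s.map (min · (k + 1))).sum := by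
  induction s using Multiset.induction_on with
  | empty => simp
  | cons a s ih =>
    simp only [Multiset.map_cons, Multiset.sum_cons, Multiset.count_cons]
    split_ifs <;> omega

theorem eq_of_sum_min_eq {s t : Multiset ℕ} (hs : 0 ∉ s) (ht : 0 ∉ t)
    (h : ∀ k, (s.map (min · k)).sum = (t.map (min · k)).sum) : s = t := by
  ext k
  rcases k with _ | k
  · rw [Multiset.count_eq_zero_of_notMem hs, Multiset.count_eq_zero_of_notMem ht]
  · have h1 := count_add_sum_min s k
    have h2 := count_add_sum_min t k
    rw [h, h, h] at h1
    omega

/-! ### The module of a given type -/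

section TypeModule

variable {F : Type*} [Field F]

theorem card_quotient_span_pow [Finite F] {f : F[X]} (hf : f.Monic) (k : ℕ) :
    Nat.card (F[X] ⧸ Ideal.span {f ^ k}) = (Nat.card F ^ f.natDegree) ^ k := by
  have : Module.Finite F (F[X] ⧸ Ideal.span {f ^ k}) :=
    (hf.pow k).finite_quotient
  rw [Module.natCard_eq_pow_finrank (K := F), finrank_quotient_span_eq_natDegree, hf.natDegree_pow,
    ← pow_mul, mul_comm]

theorem isCoprime_of_monic_irreducible {f g : F[X]} (hf : f.Monic ∧ Irreducible f)
    (hg : g.Monic ∧ Irreducible g) (hfg : f ≠ g) : IsCoprime f g := by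
  refine hf.2.coprime_iff_not_dvd.mpr fun h => hfg ?_
  exact eq_of_monic_of_associated hf.1 hg.1 (hf.2.associated_of_dvd hg.2 h)

/-- The module `∏ f, ∏ i ∈ τ f, F[X] / (f ^ i)`, for a family `τ` of multisets indexed by a finite
set `S` of polynomials. -/
abbrev TypeModule (S : Finset F[X]) (τ : S → Multiset ℕ) : Type _ :=
  ∀ f : S, PrimaryModule (f : F[X]) (fun i : τ f => i.1)

theorem smul_X_injective_typeModule {S : Finset F[X]}
    (hS : ∀ f ∈ S, f.Monic ∧ Irreducible f) (hX : X ∉ S) (τ : S → Multiset ℕ) {x : TypeModule S τ}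
    (hx : (X : F[X]) • x = 0) : x = 0 := by
  funext f i
  refine eq_zero_of_isCoprime_smul (b := f.1 ^ i.1) ?_ (congrFun (congrFun hx f) i)
    (smul_quotient_span_self _ _)
  exact (isCoprime_of_monic_irreducible ⟨monic_X, irreducible_X⟩ (hS f.1 f.2)
    fun h => hX (h ▸ f.2)).pow_right

variable [Finite F] {S : Finset F[X]} (hS : ∀ f ∈ S, f.Monic ∧ Irreducible f)
include hS

theorem card_typeModule (τ : S → Multiset ℕ) :
    Nat.card (TypeModule S τ) = Nat.card F ^ ∑ f : S, f.1.natDegree * (τ f).sum := by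
  rw [Nat.card_pi, ← Finset.prod_pow_eq_pow_sum]
  refine Finset.prod_congr rfl fun f _ => ?_
  rw [Nat.card_pi, pow_mul]
  simp only [card_quotient_span_pow (hS f.1 f.2).1, Finset.prod_pow_eq_pow_sum]
  congr 1
  conv_rhs => rw [← Multiset.map_univ_coe (τ f)]
  rfl

theorem finite_typeModule (τ : S → Multiset ℕ) : Finite (TypeModule S τ) :=
  Nat.finite_of_card_ne_zero (by rw [card_typeModule hS]; exact pow_ne_zero _ Nat.card_pos.ne')

theorem card_typeModule_equiv {τ : S → Multiset ℕ} (hτ : ∀ f, 0 ∉ τ f) :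
    (Nat.card (TypeModule S τ ≃ₗ[F[X]] TypeModule S τ) : ℝ) =
      ∏ f : S, aeval ((Nat.card F : ℝ) ^ f.1.natDegree) (centralizerPoly (τ f)) := by
  classical
  rw [card_pi_equiv_of_coprime (a := fun f : S => f.1 ^ (τ f).sum), Nat.cast_prod]
  · refine Finset.prod_congr rfl fun f _ => ?_
    rw [card_primaryModule_equiv (hS f.1 f.2).2.prime (pow_ne_zero _ Nat.card_pos.ne')
      (card_quotient_span_pow (hS f.1 f.2).1) (hτ f)]
    push_cast
    rfl
  · intro f x
    funext i
    rw [Pi.smul_apply, Pi.zero_apply,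
      ← Nat.sub_add_cancel (Multiset.le_sum_of_mem (Multiset.coe_mem (x := i))), pow_add, mul_smul,
      smul_quotient_span_self, smul_zero]
  · intro f g hfg
    exact (isCoprime_of_monic_irreducible (hS f.1 f.2) (hS g.1 g.2)
      fun h => hfg (Subtype.ext h)).pow

/-- The factors belonging to polynomials other than `f` have no `f`-torsion. -/
theorem card_torsion_typeModule (τ : S → Multiset ℕ) (f : S) (k : ℕ) :
    Nat.card {x : TypeModule S τ // f.1 ^ k • x = 0} =
      (Nat.card F ^ f.1.natDegree) ^ ((τ f).map (min · k)).sum := by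
  classical
  have e1 : {x : TypeModule S τ // f.1 ^ k • x = 0} ≃
      ∀ g : S, ∀ i : τ g, {y : F[X] ⧸ Ideal.span {g.1 ^ i.1} // f.1 ^ k • y = 0} :=
    { toFun := fun x g i => ⟨x.1 g i, congrFun (congrFun x.2 g) i⟩
      invFun := fun y => ⟨fun g i => (y g i).1, funext fun g => funext fun i => (y g i).2⟩
      left_inv := fun x => rfl
      right_inv := fun y => rfl }
  rw [Nat.card_congr e1, Nat.card_pi, Finset.prod_eq_single f]
  · rw [Nat.card_pi]
    simp only [card_torsion_pow_quotient_pow (hS f.1 f.2).1.ne_zero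
      (pow_ne_zero _ Nat.card_pos.ne') (card_quotient_span_pow (hS f.1 f.2).1),
      Finset.prod_pow_eq_pow_sum]
    congr 1
    conv_rhs => rw [← Multiset.map_univ_coe (τ f), Multiset.map_map]
    rfl
  · intro g _ hgf
    rw [Nat.card_pi]
    refine Finset.prod_eq_one fun i _ => ?_
    rw [Nat.card_eq_one_iff_unique]
    refine ⟨⟨fun x y => Subtype.ext ?_⟩, ⟨⟨0, smul_zero _⟩⟩⟩
    have hco : IsCoprime (f.1 ^ k) (g.1 ^ i.1) := (isCoprime_of_monic_irreducible (hS f.1 f.2)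
      (hS g.1 g.2) fun h => hgf (Subtype.ext h.symm)).pow
    rw [eq_zero_of_isCoprime_smul hco x.2 (smul_quotient_span_self _ _),
      eq_zero_of_isCoprime_smul hco y.2 (smul_quotient_span_self _ _)]
  · simp

/-- The type of a module is determined by its isomorphism class, as it can be read off from the
numbers of elements killed by the powers of the irreducible polynomials. -/
theorem eq_of_typeModule_equiv {τ τ' : S → Multiset ℕ} (hτ : ∀ f, 0 ∉ τ f) (hτ' : ∀ f, 0 ∉ τ' f)
    (φ : TypeModule S τ ≃ₗ[F[X]] TypeModule S τ') : τ = τ' := by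
  funext f
  refine eq_of_sum_min_eq (hτ f) (hτ' f) fun k => ?_
  have h1 : Nat.card {x : TypeModule S τ // f.1 ^ k • x = 0} =
      Nat.card {x : TypeModule S τ' // f.1 ^ k • x = 0} :=
    Nat.card_congr (φ.toEquiv.subtypeEquiv fun x => by
      change _ ↔ f.1 ^ k • φ x = 0
      rw [← map_smul, LinearEquiv.map_eq_zero_iff])
  rw [card_torsion_typeModule hS, card_torsion_typeModule hS] at h1
  exact Nat.pow_right_injective
    (Nat.one_lt_pow (hS f.1 f.2).2.natDegree_pos.ne' Finite.one_lt_card) h1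

end TypeModule

/-! ### Elementary divisors and types -/

section ElementaryDivisors

variable {F : Type*} [Field F]

theorem card_fiber_eq_count_partsAt {r : ℕ} (p : Fin r → F[X]) (e : Fin r → ℕ) (g : F[X]) (n : ℕ) :
    Nat.card {a // (p a, e a) = (g, n)} = (partsAt p e g).count n := by
  classical
  rw [partsAt, Multiset.count_map, ← Finset.filter_val, ← Finset.card_def, Nat.subtype_card]
  intro a
  simp [eq_comm]

theorem card_fiber_eq_count {S : Finset F[X]} (τ : S → Multiset ℕ) (f : S) (n : ℕ) :
    Nat.card {x : Σ f : S, τ f // (x.1.1, x.2.1) = (f.1, n)} = (τ f).count n := by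
  rw [← card_toType_fiber (τ f) n, ← Nat.card_eq_fintype_card]
  refine (Nat.card_congr (Equiv.ofBijective (fun i : {i : τ f // i.1 = n} =>
    (⟨⟨f, i.1⟩, Prod.ext rfl i.2⟩ : {x : Σ f : S, τ f // (x.1.1, x.2.1) = (f.1, n)})) ⟨?_, ?_⟩)).symm
  · intro i j hij
    simpa [Subtype.ext_iff] using hij
  · rintro ⟨⟨⟨f', hf'⟩, i⟩, h⟩
    obtain ⟨h1, h2⟩ := Prod.mk.inj h
    obtain ⟨f, hf⟩ := f
    obtain rfl : f' = f := h1
    exact ⟨⟨i, h2⟩, rfl⟩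

/-- Regrouping a direct sum of cyclic modules according to the irreducible polynomial. -/
theorem nonempty_directSum_equiv_typeModule {S : Finset F[X]} {τ : S → Multiset ℕ} {r : ℕ}
    {p : Fin r → F[X]} {e : Fin r → ℕ} (σ : Fin r ≃ Σ f : S, τ f)
    (hσ : ∀ a, (((σ a).1 : F[X]), (σ a).2.1) = (p a, e a)) :
    Nonempty ((⨁ a : Fin r, F[X] ⧸ Ideal.span {p a ^ e a}) ≃ₗ[F[X]] TypeModule S τ) := by
  obtain rfl : p = fun a => ((σ a).1 : F[X]) := funext fun a => (Prod.mk.inj (hσ a)).1.symm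
  obtain rfl : e = fun a => (σ a).2.1 := funext fun a => (Prod.mk.inj (hσ a)).2.symm
  exact ⟨(DirectSum.linearEquivFunOnFintype F[X] (Fin r) _).trans
    ((LinearEquiv.piCongrLeft F[X]
      (fun x : Σ f : S, τ f => F[X] ⧸ Ideal.span {(x.1 : F[X]) ^ x.2.1}) σ).trans
    (LinearEquiv.piCurry F[X] fun (f : S) (i : τ f) => F[X] ⧸ Ideal.span {(f : F[X]) ^ i.1}))⟩

/-- The multisets of parts allowed by `Lam`: the empty one, and those of the members of `Lam`. -/
def allowedParts (Lam : Set PosPartition) : Set (Multiset ℕ) :=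
  {μ | μ = 0 ∨ ∃ lam ∈ Lam, lam.parts = μ}

theorem zero_notMem_of_mem_allowedParts {Lam : Set PosPartition} {μ : Multiset ℕ}
    (h : μ ∈ allowedParts Lam) : 0 ∉ μ := by
  rcases h with rfl | ⟨lam, -, rfl⟩
  · simp
  · exact fun h => lt_irrefl _ (lam.2.parts_pos h)

variable [Finite F]

/-- An elementary divisor of an invertible `d × d` matrix is a power of a polynomial other than `X`
and of degree at most `d`. -/
theorem IsElementaryDivisors.mem_irreduciblesUpTo {d : ℕ} {g : GL (Fin d) F} {r : ℕ}
    {p : Fin r → F[X]} {e : Fin r → ℕ}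
    (h : IsElementaryDivisors (g : Matrix (Fin d) (Fin d) F) p e) (a : Fin r) :
    p a ∈ irreduciblesUpTo F d := by
  classical
  obtain ⟨h1, ⟨φ⟩⟩ := h
  obtain ⟨hm, hi, he⟩ := h1 a
  -- each cyclic summand embeds into the module
  let ψ : (F[X] ⧸ Ideal.span {p a ^ e a}) →ₗ[F[X]]
      Module.AEval' (Matrix.toLin' (g : Matrix (Fin d) (Fin d) F)) :=
    φ.symm.toLinearMap ∘ₗ DirectSum.lof F[X] (Fin r) (fun a => F[X] ⧸ Ideal.span {p a ^ e a}) a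
  have hψ : Function.Injective ψ :=
    φ.symm.injective.comp (DirectSum.of_injective (β := fun a => F[X] ⧸ Ideal.span {p a ^ e a}) a)
  refine _root_.mem_irreduciblesUpTo.mpr ⟨hm, hi, fun hX => ?_, ?_⟩
  · -- `X` acts injectively, but annihilates the class of `X ^ (e a - 1)` in `F[X] / (X ^ e a)`
    have hinj : ∀ m : Module.AEval' (Matrix.toLin' (g : Matrix (Fin d) (Fin d) F)),
        (X : F[X]) • m = 0 → m = 0 := by
      intro m hm
      obtain ⟨v, rfl⟩ := (Module.AEval'.of _).surjective m
      rw [Module.AEval'.X_smul_of, LinearEquiv.map_eq_zero_iff, Matrix.toLin'_apply] at hm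
      have : (↑g⁻¹ : Matrix (Fin d) (Fin d) F).mulVec ((g : Matrix _ _ F).mulVec v) = v := by
        rw [Matrix.mulVec_mulVec, ← Units.val_mul, inv_mul_cancel, Units.val_one,
          Matrix.one_mulVec]
      rw [← this, hm, Matrix.mulVec_zero, map_zero]
    have h2 : ψ (Ideal.Quotient.mk _ (X ^ (e a - 1))) = 0 := by
      apply hinj
      rw [← map_smul, smul_mk_eq_zero_iff.mpr, map_zero]
      rw [hX, ← pow_succ', Nat.sub_add_cancel he]
    have h3 := hψ (h2.trans (map_zero ψ).symm)
    rw [Ideal.Quotient.eq_zero_iff_dvd, hX] at h3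
    have := (pow_dvd_pow_iff (X_ne_zero (R := F)) not_isUnit_X).mp h3
    omega
  · have : Finite (Module.AEval' (Matrix.toLin' (g : Matrix (Fin d) (Fin d) F))) :=
      Finite.of_equiv _ (Module.AEval'.of _).toEquiv
    have h2 := Nat.card_le_card_of_injective ψ hψ
    rw [card_quotient_span_pow hm, Nat.card_congr (Module.AEval'.of _).toEquiv.symm, Nat.card_fun,
      Nat.card_fin, ← pow_mul, Nat.pow_le_pow_iff_right Finite.one_lt_card] at h2
    exact (Nat.le_mul_of_pos_right _ he).trans h2

theorem isOfType_iff {Lam : Set PosPartition} {d : ℕ} (g : GL (Fin d) F) :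
    IsOfType Lam (g : Matrix (Fin d) (Fin d) F) ↔
      ∃ τ : irreduciblesUpTo F d → Multiset ℕ, (∀ f, τ f ∈ allowedParts Lam) ∧
        Nonempty (Module.AEval' (Matrix.toLin' (g : Matrix (Fin d) (Fin d) F)) ≃ₗ[F[X]]
          TypeModule (irreduciblesUpTo F d) τ) := by
  constructor
  · rintro ⟨r, p, e, h, hparts⟩
    refine ⟨fun f => partsAt p e f, fun f => hparts f (mem_irreduciblesUpTo.mp f.2).1
      (mem_irreduciblesUpTo.mp f.2).2.1, ?_⟩
    obtain ⟨σ, hσ⟩ := exists_equiv_of_card_fiber_eq (u := fun a => (p a, e a))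
      (v := fun x : Σ f : irreduciblesUpTo F d, partsAt p e f => (x.1.1, x.2.1)) (by
        rintro ⟨f, n⟩
        by_cases hf : f ∈ irreduciblesUpTo F d
        · rw [card_fiber_eq_count_partsAt]
          exact (card_fiber_eq_count (fun f : irreduciblesUpTo F d => partsAt p e f) ⟨f, hf⟩ n).symm
        · have h1 : IsEmpty {a // (p a, e a) = (f, n)} :=
            ⟨fun a => hf ((Prod.mk.inj a.2).1 ▸ h.mem_irreduciblesUpTo a.1)⟩
          have h2 : IsEmpty {x : Σ f : irreduciblesUpTo F d, partsAt p e f //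
              (x.1.1, x.2.1) = (f, n)} := ⟨fun x => hf ((Prod.mk.inj x.2).1 ▸ x.1.1.2)⟩
          rw [Nat.card_of_isEmpty, Nat.card_of_isEmpty])
    obtain ⟨φ⟩ := h.2
    obtain ⟨ψ⟩ := nonempty_directSum_equiv_typeModule σ hσ
    exact ⟨φ.trans ψ⟩
  · rintro ⟨τ, hτ, ⟨φ⟩⟩
    let σ := (Fintype.equivFin (Σ f : irreduciblesUpTo F d, τ f)).symm
    obtain ⟨ψ⟩ := nonempty_directSum_equiv_typeModule σ fun a => rfl
    refine ⟨_, fun a => ((σ a).1 : F[X]), fun a => (σ a).2.1, ⟨fun a => ?_, ⟨φ.trans ψ.symm⟩⟩, ?_⟩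
    · have := mem_irreduciblesUpTo.mp (σ a).1.2
      refine ⟨this.1, this.2.1, Nat.pos_of_ne_zero fun h => ?_⟩
      exact zero_notMem_of_mem_allowedParts (hτ (σ a).1) (h ▸ Multiset.coe_mem)
    · intro f _ _
      by_cases hf : f ∈ irreduciblesUpTo F d
      · have : partsAt (fun a => ((σ a).1 : F[X])) (fun a => (σ a).2.1) f = τ ⟨f, hf⟩ := by
          ext n
          rw [← card_fiber_eq_count_partsAt, ← card_fiber_eq_count τ ⟨f, hf⟩ n]
          exact Nat.card_congr (σ.subtypeEquiv fun a => Iff.rfl)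
        rw [this]
        exact hτ ⟨f, hf⟩
      · left
        ext n
        have : IsEmpty {a // (((σ a).1 : F[X]), (σ a).2.1) = (f, n)} :=
          ⟨fun a => hf ((Prod.mk.inj a.2).1 ▸ (σ a.1).1.2)⟩
        rw [← card_fiber_eq_count_partsAt, Nat.card_of_isEmpty, Multiset.count_zero]

end ElementaryDivisors

/-! ### The size of a conjugacy class -/

section ConjugacyClass

variable {F : Type*} [Field F] [Finite F] {d : ℕ} {M : Type*} [AddCommGroup M] [Module F M]
  [Module F[X] M] [IsScalarTower F F[X] M]

/-- Orbit counting: an `F`-linear isomorphism `ψ : F ^ d ≃ M` is the same thing as a matrix `g`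
together with an `F[X]`-linear isomorphism from `F ^ d`, with `X` acting as `g`, to `M`. -/
theorem card_equiv_mul_card_equiv (ψ₀ : (Fin d → F) ≃ₗ[F] M)
    (hX : ∀ m : M, (X : F[X]) • m = 0 → m = 0) :
    Nat.card {g : GL (Fin d) F // Nonempty (Module.AEval'
      (Matrix.toLin' (g : Matrix (Fin d) (Fin d) F)) ≃ₗ[F[X]] M)} * Nat.card (M ≃ₗ[F[X]] M) =
      Nat.card (GL (Fin d) F) := by
  classical
  have hM : Finite M := Finite.of_equiv _ ψ₀.toEquiv
  have hV : Finite ((Fin d → F) ≃ₗ[F] M) := Finite.of_injective _ DFunLike.coe_injective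
  let E : GL (Fin d) F ≃ ((Fin d → F) ≃ₗ[F] (Fin d → F)) :=
    (Matrix.GeneralLinearGroup.toLin.trans
      (LinearMap.GeneralLinearGroup.generalLinearEquiv F (Fin d → F))).toEquiv
  have hE : ∀ g v, E g v = Matrix.toLin' (g : Matrix (Fin d) (Fin d) F) v := fun g v => rfl
  -- multiplication by `X`, as an `F`-linear automorphism of `M`
  have hXinj : Function.Injective (Algebra.lsmul F F M (X : F[X])) :=
    (injective_iff_map_eq_zero _).mpr hX
  let x : M ≃ₗ[F] M := LinearEquiv.ofBijective (Algebra.lsmul F F M (X : F[X]))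
    ⟨hXinj, Finite.injective_iff_surjective.mp hXinj⟩
  have hx : ∀ m, x m = (X : F[X]) • m := fun m => rfl
  let T : ((Fin d → F) ≃ₗ[F] M) → GL (Fin d) F := fun ψ => E.symm ((ψ.trans x).trans ψ.symm)
  have hT : ∀ ψ g, T ψ = g ↔ ∀ v, ψ (Matrix.toLin' (g : Matrix (Fin d) (Fin d) F) v) =
      (X : F[X]) • ψ v := by
    intro ψ g
    rw [Equiv.symm_apply_eq]
    constructor
    · intro h v
      rw [← hE, ← h]
      simp [hx]
    · intro h
      refine LinearEquiv.ext fun v => ?_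
      apply ψ.injective
      rw [hE, h]
      simp [hx]
  have hfiber : ∀ g, {ψ // T ψ = g} ≃ (Module.AEval'
      (Matrix.toLin' (g : Matrix (Fin d) (Fin d) F)) ≃ₗ[F[X]] M) := fun g =>
    { toFun := fun ψ => LinearEquiv.ofAEval _ ψ.1 ((hT ψ.1 g).mp ψ.2)
      invFun := fun Φ => ⟨(Module.AEval'.of _).trans (Φ.restrictScalars F), (hT _ g).mpr fun v =>
        (congrArg Φ (Module.AEval'.X_smul_of _ v)).symm.trans (map_smul Φ _ _)⟩
      left_inv := fun ψ => rfl
      right_inv := fun Φ => rfl }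
  have h1 : Nat.card ((Fin d → F) ≃ₗ[F] M) = Nat.card (GL (Fin d) F) := by
    refine Nat.card_congr (Equiv.trans ?_ E.symm)
    exact ⟨fun ψ => ψ.trans ψ₀.symm, fun ψ => ψ.trans ψ₀, fun ψ => by ext; simp,
      fun ψ => by ext; simp⟩
  have := Fintype.ofFinite (GL (Fin d) F)
  rw [← h1, ← Nat.card_congr (Equiv.sigmaFiberEquiv T), Nat.card_sigma]
  have h2 : ∀ g, Nat.card {ψ // T ψ = g} = if Nonempty (Module.AEval'
      (Matrix.toLin' (g : Matrix (Fin d) (Fin d) F)) ≃ₗ[F[X]] M) then Nat.card (M ≃ₗ[F[X]] M)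
      else 0 := by
    intro g
    rw [Nat.card_congr (hfiber g)]
    split_ifs with h
    · obtain ⟨Φ⟩ := h
      exact Nat.card_congr ⟨fun Ψ => Φ.symm.trans Ψ, fun Ψ => Φ.trans Ψ,
        fun Ψ => by ext; simp, fun Ψ => by ext; simp⟩
    · rw [not_nonempty_iff] at h
      exact Nat.card_of_isEmpty
  rw [Finset.sum_congr rfl fun g _ => h2 g, ← Finset.sum_filter, Finset.sum_const, smul_eq_mul]
  congr 1
  rw [Nat.subtype_card]
  simp

end ConjugacyClass

/-! ### The generating function of the probabilities -/

theorem finite_setOf_allowedParts (Lam : Set PosPartition) (l : ℕ) :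
    {μ | μ ∈ allowedParts Lam ∧ μ.sum ≤ l}.Finite := by
  have h : (⋃ m ∈ Set.Iic l, Set.range (Nat.Partition.parts (n := m))).Finite :=
    (Set.finite_Iic l).biUnion fun m _ => Set.finite_range _
  refine h.subset fun μ hμ => ?_
  simp only [Set.mem_iUnion]
  exact ⟨μ.sum, hμ.2, ⟨μ, fun hi => Nat.pos_of_ne_zero fun h0 =>
    zero_notMem_of_mem_allowedParts hμ.1 (h0 ▸ hi), rfl⟩, rfl⟩

/-- The allowed multisets of parts with sum at most `l`. -/
noncomputable def boundedParts (Lam : Set PosPartition) (l : ℕ) : Finset (Multiset ℕ) :=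
  (finite_setOf_allowedParts Lam l).toFinset

@[simp] theorem mem_boundedParts {Lam : Set PosPartition} {l : ℕ} {μ : Multiset ℕ} :
    μ ∈ boundedParts Lam l ↔ μ ∈ allowedParts Lam ∧ μ.sum ≤ l := by
  simp [boundedParts]

/-- The factor `1 + ∑ lam ∈ Lam, u ^ (n |lam|) / C_{GL, lam}(q ^ n)` of the generating function that
is contributed by an irreducible polynomial of degree `n ≠ 0`. The empty multiset of parts yields
the summand `1`; as `n ≠ 0`, the bound `l` on the sums of parts excludes no term. -/
noncomputable def typeSeries (Lam : Set PosPartition) (q : ℝ) (n : ℕ) : PowerSeries ℝ :=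
  PowerSeries.mk fun l => ∑ μ ∈ boundedParts Lam l with n * μ.sum = l,
    (aeval (q ^ n) (centralizerPoly μ))⁻¹

section Probability

variable {F : Type*} [Field F] [Finite F]

open Classical in
/-- The types of the matrices of `Lam`-type in `GL(d, F)`. -/
noncomputable def matrixTypes (F : Type*) [Field F] [Finite F] (Lam : Set PosPartition) (d : ℕ) :
    Finset (irreduciblesUpTo F d → Multiset ℕ) :=
  {τ ∈ Fintype.piFinset fun _ => boundedParts Lam d | ∑ f, f.1.natDegree * (τ f).sum = d}

theorem natDegree_pos_of_mem {d : ℕ} (f : irreduciblesUpTo F d) : 0 < f.1.natDegree :=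
  (mem_irreduciblesUpTo.mp f.2).2.1.natDegree_pos

theorem mem_matrixTypes {Lam : Set PosPartition} {d : ℕ}
    {τ : irreduciblesUpTo F d → Multiset ℕ} :
    τ ∈ matrixTypes F Lam d ↔
      (∀ f, τ f ∈ allowedParts Lam) ∧ ∑ f, f.1.natDegree * (τ f).sum = d := by
  classical
  rw [matrixTypes, Finset.mem_filter, Fintype.mem_piFinset]
  refine and_congr_left fun h => forall_congr' fun f => ?_
  rw [mem_boundedParts, and_iff_left_iff_imp]
  intro _
  calc (τ f).sum ≤ f.1.natDegree * (τ f).sum := Nat.le_mul_of_pos_left _ (natDegree_pos_of_mem f)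
    _ ≤ ∑ f, f.1.natDegree * (τ f).sum := Finset.single_le_sum
        (f := fun f : irreduciblesUpTo F d => f.1.natDegree * (τ f).sum)
        (fun _ _ => Nat.zero_le _) (Finset.mem_univ f)
    _ = d := h

theorem monic_irreducible_of_mem (d : ℕ) :
    ∀ f ∈ irreduciblesUpTo F d, f.Monic ∧ Irreducible f := fun _ hf =>
  ⟨(mem_irreduciblesUpTo.mp hf).1, (mem_irreduciblesUpTo.mp hf).2.1⟩

theorem probGL_eq_sum (Lam : Set PosPartition) (d : ℕ) :
    probGL Lam d F = ∑ τ ∈ matrixTypes F Lam d, ∏ f,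
      (aeval ((Nat.card F : ℝ) ^ f.1.natDegree) (centralizerPoly (τ f)))⁻¹ := by
  classical
  have := Fintype.ofFinite (GL (Fin d) F)
  have hS := monic_irreducible_of_mem (F := F) d
  have hXS : X ∉ irreduciblesUpTo F d := fun h => (mem_irreduciblesUpTo.mp h).2.2.1 rfl
  -- `cl τ` is the conjugacy class of the matrices of type `τ`
  set cl : (irreduciblesUpTo F d → Multiset ℕ) → GL (Fin d) F → Prop := fun τ g =>
    Nonempty (Module.AEval' (Matrix.toLin' (g : Matrix (Fin d) (Fin d) F)) ≃ₗ[F[X]]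
      TypeModule (irreduciblesUpTo F d) τ) with hcl
  have hsize : ∀ τ g, cl τ g → ∑ f : irreduciblesUpTo F d, f.1.natDegree * (τ f).sum = d := by
    rintro τ g ⟨φ⟩
    have h1 := card_typeModule hS τ
    rw [← Nat.card_congr φ.toEquiv, Nat.card_congr (Module.AEval'.of _).toEquiv.symm, Nat.card_fun,
      Nat.card_fin] at h1
    exact (Nat.pow_right_injective Finite.one_lt_card h1).symm
  have h1 : Finset.univ.filter (fun g : GL (Fin d) F => IsOfType Lam (g : Matrix (Fin d) (Fin d) F)) =
      (matrixTypes F Lam d).biUnion fun τ => Finset.univ.filter (cl τ) := by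
    ext g
    simp only [Finset.mem_filter, Finset.mem_univ, true_and, Finset.mem_biUnion, isOfType_iff,
      mem_matrixTypes]
    exact exists_congr fun τ => ⟨fun h => ⟨⟨h.1, hsize τ g h.2⟩, h.2⟩, fun h => ⟨h.1.1, h.2⟩⟩
  have hdisj : Set.PairwiseDisjoint (matrixTypes F Lam d : Set _)
      fun τ => Finset.univ.filter (cl τ) := by
    intro τ hτ τ' hτ' hne
    refine Finset.disjoint_left.mpr fun g hg hg' => hne ?_
    obtain ⟨φ⟩ := (Finset.mem_filter.mp hg).2
    obtain ⟨φ'⟩ := (Finset.mem_filter.mp hg').2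
    exact eq_of_typeModule_equiv hS
      (fun f => zero_notMem_of_mem_allowedParts ((mem_matrixTypes.mp hτ).1 f))
      (fun f => zero_notMem_of_mem_allowedParts ((mem_matrixTypes.mp hτ').1 f)) (φ.symm.trans φ')
  have hG : (Nat.card (GL (Fin d) F) : ℝ) ≠ 0 := by exact_mod_cast Nat.card_pos.ne'
  rw [probGL, Nat.subtype_card (Finset.univ.filter
    (fun g : GL (Fin d) F => IsOfType Lam (g : Matrix (Fin d) (Fin d) F))) (by simp), h1,
    Finset.card_biUnion hdisj, Nat.cast_sum, Finset.sum_div]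
  refine Finset.sum_congr rfl fun τ hτ => ?_
  obtain ⟨hτ1, hτ2⟩ := mem_matrixTypes.mp hτ
  have := finite_typeModule hS τ
  have hfr : Module.finrank F (Fin d → F) =
      Module.finrank F (TypeModule (irreduciblesUpTo F d) τ) := by
    apply Nat.pow_right_injective (Finite.one_lt_card (α := F))
    change Nat.card F ^ _ = Nat.card F ^ _
    rw [← Module.natCard_eq_pow_finrank, ← Module.natCard_eq_pow_finrank, card_typeModule hS, hτ2,
      Nat.card_fun, Nat.card_fin]
  have h2 := card_equiv_mul_card_equiv (LinearEquiv.ofFinrankEq _ _ hfr)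
    (fun m => smul_X_injective_typeModule hS hXS τ)
  have h3 := card_typeModule_equiv hS fun f => zero_notMem_of_mem_allowedParts (hτ1 f)
  rw [Nat.subtype_card (Finset.univ.filter (cl τ)) (by simp [hcl])] at h2
  rw [Finset.prod_inv_distrib, ← h3, ← h2, Nat.cast_mul]
  rw [← h2, Nat.cast_mul] at hG
  rw [div_mul_cancel_left₀ (left_ne_zero_of_mul hG)]

/-- The cycle index: the probability is the coefficient of `u ^ d` in a product over the monic
irreducible polynomials. -/
theorem probGL_eq_coeff_prod (Lam : Set PosPartition) (d : ℕ) :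
    probGL Lam d F = PowerSeries.coeff d
      (∏ f ∈ irreduciblesUpTo F d, typeSeries Lam (Nat.card F) f.natDegree) := by
  classical
  rw [probGL_eq_sum, ← Finset.prod_coe_sort, PowerSeries.coeff_prod]
  -- the types are sorted by the degrees `deg f * |τ f|` of their primary parts
  let g : (irreduciblesUpTo F d → Multiset ℕ) → (irreduciblesUpTo F d →₀ ℕ) := fun τ =>
    Finsupp.equivFunOnFinite.symm fun f => f.1.natDegree * (τ f).sum
  rw [← Finset.sum_fiberwise_of_maps_to (g := g) (t := Finset.univ.finsuppAntidiag d)]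
  · refine Finset.sum_congr rfl fun l hl => ?_
    simp only [typeSeries, PowerSeries.coeff_mk]
    rw [Finset.prod_univ_sum]
    refine Finset.sum_congr ?_ fun _ _ => rfl
    ext τ
    rw [Finset.mem_finsuppAntidiag] at hl
    have hg : g τ = l ↔ ∀ f, f.1.natDegree * (τ f).sum = l f := DFunLike.ext_iff
    rw [Finset.mem_filter, mem_matrixTypes, Fintype.mem_piFinset, hg]
    simp only [Finset.mem_filter, mem_boundedParts]
    constructor
    · rintro ⟨⟨h1, -⟩, h3⟩ f
      exact ⟨⟨h1 f, (Nat.le_mul_of_pos_left _ (natDegree_pos_of_mem f)).trans (h3 f).le⟩, h3 f⟩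
    · intro h
      refine ⟨⟨fun f => (h f).1.1, ?_⟩, fun f => (h f).2⟩
      exact (Finset.sum_congr rfl fun f _ => (h f).2).trans hl.1
  · intro τ hτ
    rw [Finset.mem_finsuppAntidiag]
    exact ⟨(mem_matrixTypes.mp hτ).2, Finset.subset_univ _⟩

end Probability

/-! ### Expansion of the probabilities -/

namespace HasExpansion

variable {I : Type*} {q : I → ℝ} {h : I → ℝ}

theorem pow_mul (hq : ∀ i, q i ≠ 0) {s n : ℕ} (hns : n ≤ s) (H : HasExpansion q s h) :
    HasExpansion q (s - n : ℕ) (fun i => q i ^ n * h i) := by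
  obtain ⟨φ, h1, h2⟩ := H
  refine ⟨PowerSeries.mk fun j => PowerSeries.coeff (j + n) φ, fun i => ?_, fun j hj => ?_⟩
  · have h3 := ((hasSum_nat_add_iff' n).mpr (h1 i)).mul_left (q i ^ n)
    rw [Finset.sum_eq_zero fun j hj => by
      rw [h2 j (by exact_mod_cast (Finset.mem_range.mp hj).trans_le hns), zero_mul], sub_zero] at h3
    refine (congrArg (HasSum · (q i ^ n * h i)) (funext fun j => ?_)).mpr h3
    have := pow_ne_zero n (hq i)
    rw [PowerSeries.coeff_mk, pow_add (q i)⁻¹ j n, _root_.inv_pow (q i) n]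
    field_simp
  · rw [PowerSeries.coeff_mk]
    refine h2 _ ?_
    have : j < s - n := by exact_mod_cast hj
    exact_mod_cast (by omega : j + n < s)

end HasExpansion

/-- The degree of `centralizerPoly lam.parts` is `Δ(lam)`, by definition. -/
theorem sigmaGL_mul_size_le {Lam : Set PosPartition} {lam : PosPartition} (h : lam ∈ Lam) :
    sigmaGL Lam * lam.size ≤ (centralizerPoly lam.parts).natDegree - 1 := by
  have hsize : (0 : ℝ) < lam.size := by exact_mod_cast lam.1.pos
  rw [← le_div_iff₀ hsize]
  refine csInf_le ⟨-1, ?_⟩ ⟨lam, h, rfl⟩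
  rintro _ ⟨μ, -, rfl⟩
  have hsize' : (1 : ℝ) ≤ μ.size := by exact_mod_cast μ.1.pos
  have hD : (0 : ℝ) ≤ μ.Delta := Nat.cast_nonneg _
  change -1 ≤ ((μ.Delta : ℝ) - 1) / (μ.size : ℝ)
  rw [le_div_iff₀ (by linarith)]
  linarith

theorem constantCoeff_typeSeries (Lam : Set PosPartition) (q : ℝ) (n : ℕ) :
    PowerSeries.constantCoeff (typeSeries Lam q n) = 1 := by
  rw [← PowerSeries.coeff_zero_eq_constantCoeff_apply, typeSeries, PowerSeries.coeff_mk]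
  have : {μ ∈ boundedParts Lam 0 | n * μ.sum = 0} = {0} := by
    ext μ
    rw [Finset.mem_filter, mem_boundedParts, Finset.mem_singleton]
    constructor
    · rintro ⟨⟨h1, h2⟩, -⟩
      refine Multiset.eq_zero_of_forall_notMem fun i hi => ?_
      have h3 := Multiset.le_sum_of_mem hi
      obtain rfl : i = 0 := by omega
      exact zero_notMem_of_mem_allowedParts h1 hi
    · rintro rfl
      exact ⟨⟨Or.inl rfl, le_rfl⟩, by simp⟩
  rw [this, Finset.sum_singleton, centralizerPoly_zero, map_one, inv_one]

/-- A partition `lam` contributes `q ^ n / C_{GL, lam}(q ^ n)`, of order `n (Δ(lam) - 1)`, to the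
coefficient of `u ^ (n |lam|)`; the definition of `σ` bounds this order below. -/
theorem hasExpansions_pow_mul_typeSeries {I : Type*} {q : I → ℝ} (hq : ∀ i, 1 < q i)
    (Lam : Set PosPartition) {n : ℕ} (hn : n ≠ 0) :
    HasExpansions q (sigmaGL Lam)
      (fun i => PowerSeries.C (q i ^ n) * (typeSeries Lam (q i) n - 1)) := by
  intro e
  rcases eq_or_ne e 0 with rfl | he
  · simp only [PowerSeries.coeff_zero_eq_constantCoeff_apply, map_mul, map_sub,
      constantCoeff_typeSeries, map_one, sub_self, mul_zero]
    exact HasExpansion.zero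
  simp only [PowerSeries.coeff_C_mul, map_sub, PowerSeries.coeff_one, if_neg he, sub_zero,
    typeSeries, PowerSeries.coeff_mk, Finset.mul_sum]
  refine HasExpansion.sum _ fun μ hμ => ?_
  rw [Finset.mem_filter, mem_boundedParts] at hμ
  obtain ⟨⟨rfl | ⟨lam, hlam, rfl⟩, -⟩, he'⟩ := hμ
  · exact absurd (by simpa using he'.symm) he
  have hpos : 0 < (centralizerPoly lam.parts).natDegree := by
    refine natDegree_centralizerPoly_pos ?_
    rintro h
    rw [h] at he'
    exact he (by simpa using he'.symm)
  have h1 := HasExpansion.pow_mul (fun i => (one_pos.trans (hq i)).ne')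
    (Nat.le_mul_of_pos_right n hpos) (HasExpansion.inv_centralizerPoly hq hn lam.parts)
  refine h1.mono ?_
  have h2 : lam.parts.sum = lam.size := lam.2.parts_sum
  have h3 := mul_le_mul_of_nonneg_left (sigmaGL_mul_size_le hlam) (Nat.cast_nonneg n (α := ℝ))
  rw [← he', h2, Nat.cast_sub (Nat.le_mul_of_pos_right n hpos)]
  push_cast
  linarith

/-- A finite field, as an index: probabilities depend on the field, while their expansion has to be
the same for all fields. -/
structure BundledFiniteField : Type 1 where
  /-- The underlying type. -/
  carrier : Type
  [field : Field carrier]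
  [finite : Finite carrier]

attribute [instance] BundledFiniteField.field BundledFiniteField.finite

/-- The number of elements. -/
noncomputable def BundledFiniteField.q (K : BundledFiniteField) : ℝ := Nat.card K.carrier

theorem BundledFiniteField.one_lt_q (K : BundledFiniteField) : 1 < K.q := by
  have h : 1 < Nat.card K.carrier := Finite.one_lt_card
  exact Nat.one_lt_cast.mpr h

theorem hasExpansion_irreducibleCount {n : ℕ} (hn : n ≠ 0) :
    HasExpansion BundledFiniteField.q 0
      (fun K => (irreducibleCount K.carrier n : ℝ) * (K.q)⁻¹ ^ n) := by
  refine HasExpansion.of_sum_divisors BundledFiniteField.one_lt_q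
    (N := fun n K => (irreducibleCount K.carrier n : ℝ)) (fun n hn K => ?_) n hn
  rw [BundledFiniteField.q, ← Nat.cast_pow, ← sum_divisors_mul_irreducibleCount K.carrier hn]
  push_cast
  rfl

theorem hasExpansion_probGL (Lam : Set PosPartition) (d : ℕ) :
    HasExpansion BundledFiniteField.q (d * sigmaGL Lam) (fun K => probGL Lam d K.carrier) := by
  have key : (fun K : BundledFiniteField => probGL Lam d K.carrier) = fun K =>
      PowerSeries.coeff d (∏ n ∈ Finset.Icc 1 d, (1 + (typeSeries Lam K.q n - 1)) ^
        ({f ∈ irreduciblesUpTo K.carrier d | f.natDegree = n}.card)) := by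
    funext K
    rw [probGL_eq_coeff_prod, ← Finset.prod_fiberwise_of_maps_to (g := natDegree)
      (t := Finset.Icc 1 d)]
    · congr 1
      refine Finset.prod_congr rfl fun n _ => ?_
      rw [add_sub_cancel, ← Finset.prod_const]
      refine Finset.prod_congr rfl fun f hf => ?_
      rw [(Finset.mem_filter.mp hf).2]
      rfl
    · intro f hf
      have := mem_irreduciblesUpTo.mp hf
      exact Finset.mem_Icc.mpr ⟨this.2.1.natDegree_pos, this.2.2.2⟩
  rw [key]
  refine HasExpansions.prod (Finset.Icc 1 d) (fun n hn => ?_) d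
  obtain ⟨hn1, hnd⟩ := Finset.mem_Icc.mp hn
  have hn0 : n ≠ 0 := by omega
  refine HasExpansions.one_add_pow (n := n) (fun K => (one_pos.trans K.one_lt_q).ne') ?_
    (hasExpansions_pow_mul_typeSeries BundledFiniteField.one_lt_q Lam hn0)
    (fun K => by rw [map_sub, constantCoeff_typeSeries, map_one, sub_self])
  simp only [card_filter_irreduciblesUpTo hnd, sub_eq_add_neg, add_mul]
  exact (hasExpansion_irreducibleCount hn0).add (HasExpansion.const_mul _
    ((HasExpansion.inv_pow n).mono (by positivity)))

/-! ### Uniqueness of the expansion -/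

/-- A power series is determined by its values at the reciprocals of the primes, which accumulate
at `0`. -/
theorem eq_zero_of_hasSum_inv_prime {φ : PowerSeries ℝ}
    (h : ∀ p : ℕ, p.Prime → HasSum (fun j : ℕ => PowerSeries.coeff j φ * ((p : ℝ)⁻¹) ^ j) 0) :
    φ = 0 := by
  ext m
  induction m using Nat.strong_induction_on with
  | _ m ih =>
    rw [map_zero]
    -- after division by `p ^ (-m)`, the terms beyond the constant one are `O(1 / p)`
    have h1 : ∀ p : ℕ, p.Prime →
        HasSum (fun j : ℕ => PowerSeries.coeff (j + m) φ * ((p : ℝ)⁻¹) ^ j) 0 := by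
      intro p hp
      have hp0 : ((p : ℝ)) ^ m ≠ 0 := pow_ne_zero _ (by exact_mod_cast hp.ne_zero)
      have h3 := ((hasSum_nat_add_iff' m).mpr (h p hp)).mul_left ((p : ℝ) ^ m)
      rw [Finset.sum_eq_zero fun j hj => by
        rw [ih j (Finset.mem_range.mp hj), map_zero, zero_mul], sub_zero, mul_zero] at h3
      refine (congrArg (HasSum · (0 : ℝ)) (funext fun j => ?_)).mpr h3
      rw [pow_add (p : ℝ)⁻¹ j m, inv_pow (p : ℝ) m]
      field_simp
    have h2 := (summable_nat_add_iff 1).mpr (h1 2 Nat.prime_two).summable.norm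
    set C := ∑' j, ‖PowerSeries.coeff (j + 1 + m) φ * (((2 : ℕ) : ℝ)⁻¹) ^ (j + 1)‖ with hC
    have hbound : ∀ p : ℕ, p.Prime → p * |PowerSeries.coeff m φ| ≤ 2 * C := by
      intro p hp
      have hp2 : (2 : ℝ) ≤ p := by exact_mod_cast hp.two_le
      have h3 := (hasSum_nat_add_iff' 1).mpr (h1 p hp)
      simp only [Finset.range_one, Finset.sum_singleton, zero_add, pow_zero, mul_one,
        zero_sub] at h3
      have h4 : ∀ j, ‖PowerSeries.coeff (j + 1 + m) φ * ((p : ℝ)⁻¹) ^ (j + 1)‖ ≤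
          (2 / p) * ‖PowerSeries.coeff (j + 1 + m) φ * (((2 : ℕ) : ℝ)⁻¹) ^ (j + 1)‖ := by
        intro j
        rw [norm_mul, norm_mul, mul_left_comm]
        refine mul_le_mul_of_nonneg_left ?_ (norm_nonneg _)
        rw [norm_pow, norm_pow, norm_inv, norm_inv, Real.norm_natCast, Real.norm_natCast, pow_succ,
          pow_succ, Nat.cast_ofNat]
        have h5 : ((p : ℝ)⁻¹) ^ j ≤ ((2 : ℝ)⁻¹) ^ j :=
          pow_le_pow_left₀ (by positivity) (inv_anti₀ (by norm_num) hp2) j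
        calc ((p : ℝ)⁻¹) ^ j * (p : ℝ)⁻¹ ≤ ((2 : ℝ)⁻¹) ^ j * (p : ℝ)⁻¹ :=
              mul_le_mul_of_nonneg_right h5 (by positivity)
          _ = 2 / p * ((2 : ℝ)⁻¹ ^ j * (2 : ℝ)⁻¹) := by field_simp
      have h6 := tsum_of_norm_bounded (h2.hasSum.mul_left (2 / (p : ℝ))) h4
      rw [h3.tsum_eq, norm_neg, Real.norm_eq_abs] at h6
      have hp0 : (0 : ℝ) < p := by linarith
      calc (p : ℝ) * |PowerSeries.coeff m φ| ≤ p * (2 / p * C) :=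
            mul_le_mul_of_nonneg_left h6 hp0.le
        _ = 2 * C := by field_simp
    by_contra hne
    have habs : 0 < |PowerSeries.coeff m φ| := abs_pos.mpr hne
    obtain ⟨p, hp1, hp⟩ := Nat.exists_infinite_primes (⌈2 * C / |PowerSeries.coeff m φ|⌉₊ + 1)
    have h7 : 2 * C / |PowerSeries.coeff m φ| < p :=
      (Nat.le_ceil _).trans_lt (by exact_mod_cast hp1)
    rw [div_lt_iff₀ habs] at h7
    exact absurd (hbound p hp) (not_le.mpr h7)

theorem IsExpansionGL.unique {Lam : Set PosPartition} {d : ℕ} {φ ψ : PowerSeries ℝ}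
    (hφ : IsExpansionGL Lam d φ) (hψ : IsExpansionGL Lam d ψ) : φ = ψ := by
  rw [← sub_eq_zero]
  refine eq_zero_of_hasSum_inv_prime fun p hp => ?_
  have : Fact p.Prime := ⟨hp⟩
  have h := (hφ (ZMod p)).sub (hψ (ZMod p))
  rw [sub_self, Nat.card_zmod] at h
  simpa only [map_sub, sub_mul] using h

theorem mainTheorem6 (Lam : Set PosPartition) (hne : Lam.Nonempty)
    (hone : PosPartition.single ∉ Lam) (d : ℕ) :
    (∃! φ : PowerSeries ℝ, IsExpansionGL Lam d φ) ∧
      ∀ φ : PowerSeries ℝ, IsExpansionGL Lam d φ →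
        ∀ j : ℕ, (j : ℝ) < (d : ℝ) * sigmaGL Lam → PowerSeries.coeff j φ = 0 := by
  obtain ⟨φ, h1, h2⟩ := hasExpansion_probGL Lam d
  have hφ : IsExpansionGL Lam d φ := fun F _ _ => h1 ⟨F⟩
  refine ⟨⟨φ, hφ, fun ψ hψ => hψ.unique hφ⟩, fun ψ hψ => ?_⟩
  rw [hψ.unique hφ]
  exact h2
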